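/- Let $M$ be a smooth manifold of dimension $n+1$ and let $\pi : M \to \mathbb{R}$ be a fibration, that is, a smooth surjective submersion. Put $\eta = \pi^*(dt)$ and identify the manifold $J^1\pi$ of 1-jets of local sections of $\pi$ with the embedded submanifold $\{v \in TM : \eta(v) = 1\}$ of $TM$. Let $\pi_M : T^*M \to M$ be the cotangent bundle, $\tilde\pi_M = \pi\circ\pi_M : T^*M \to \mathbb{R}$ the induced fibration, $j : J^1\tilde\pi_M \hookrightarrow T(T^*M)$ the corresponding embedding, and $j^1\pi_M : J^1\tilde\pi_M \to J^1\pi$ the jet prolongation of $\pi_M$ (the restriction of $T\pi_M$). Let $A_M : T(T^*M) \to T^*(TM)$ be the canonical Tulczyjew diffeomorphism, given in local coordinates by $(q,p;\dot q,\dot p) \mapsto (q,\dot q;\dot p,p)$. The canonical Tulczyjew fibration associated with $\pi$ is the map $$\widetilde{A_\pi} : J^1\tilde\pi_M \to T^*(J^1\pi), \qquad \widetilde{A_\pi}(\tilde z) = A_M(j(\tilde z))|_{T_v(J^1\pi)} \in T_v^*(J^1\pi), \quad v = j^1\pi_M(\tilde z).$$ For a manifold $N$ let $\Omega_N$ be the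 canonical symplectic form of $T^*N$ (locally $dq^i\wedge dp_i$). Let $\Omega_M^c$ be the complete lift of $\Omega_M$ to $T(T^*M)$, where the complete lift to $TP$ of a form $\omega$ on a manifold $P$ is $\omega^c = i_T\, d\omega + d\,(i_T\omega)$, with $(i_T\omega)_v(\xi_1,\dots,\xi_k) = \omega(v, T\tau\,\xi_1,\dots,T\tau\,\xi_k)$ and $\tau : TP \to P$ the projection. Put $\Omega_{J^1\tilde\pi_M} = j^*(\Omega_M^c)$. Then $\widetilde{A_\pi}$ is a presymplectic map between the presymplectic manifolds $(J^1\tilde\pi_M, \Omega_{J^1\tilde\pi_M})$ and $(T^*(J^1\pi), \Omega_{J^1\pi})$; that is, both are smooth closed 2-forms, $\widetilde{A_\pi}$ is smooth, and $$\widetilde{A_\pi}^{\,*}(\Omega_{J^1\pi}) = \Omega_{J^1\tilde\pi_M}.$$ -/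

import Mathlib

open Set
open scoped Manifold ContDiff Topology
noncomputable section

section

variable {E : Type*} [NormedAddCommGroup E] [NormedSpace ℝ E] {H : Type*} [TopologicalSpace H]
 (I : ModelWithCorners ℝ E H) {M : Type*} [TopologicalSpace M] [ChartedSpace H M] 

/-- A fibration over the real line: a smooth surjective submersion `π : M → ℝ`. -/
structure IsFibration (π : M → ℝ) : Prop where
  smooth : ContMDiff I 𝓘(ℝ, ℝ) ∞ π
  surjective : Function.Surjective π
  submersion : ∀ x : M, Function.Surjective (mfderiv I 𝓘(ℝ, ℝ) π x)

/-- The 1-form `η = π^*(dt)`, as a function on the tangent bundle. -/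
def eta (π : M → ℝ) (v : TangentBundle I M) : ℝ := mfderiv I 𝓘(ℝ, ℝ) π v.proj v.2

variable [IsManifold I ∞ M] 

/-- The model fibre `ℝⁿ` of `J¹π → M`, for `M` modelled on `E` of dimension `n + 1`. -/
abbrev JetFibre (E : Type*) [NormedAddCommGroup E] [NormedSpace ℝ E] : Type :=
  EuclideanSpace ℝ (Fin (Module.finrank ℝ E - 1))

/-! Charts of the affine bundle `{v ∈ TM | η(v) = 1}` over `M`. In the tangent chart over the chart at
`x₀`, with coordinates `(y, w)`, the set is `{(y, w) | fibreMap y w = 1}`; completing `fibreMap y`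
by a fixed linear map `complement : E → ℝⁿ` to a linear isomorphism `frame y : E → ℝ × ℝⁿ` gives
the coordinates `(y, complement w)`. -/

set_option linter.unusedSectionVars false

namespace JetChart


/-- The form `η` in the chart at `x₀`. -/
def fibreMap (π : M → ℝ) (x₀ : M) (y : E) : E →L[ℝ] ℝ :=
  fderiv ℝ (π ∘ (extChartAt I x₀).symm) y

/-- The chart of `TM` induced by the chart of `M` at `x₀`. -/
def tangentChart (x₀ : M) : PartialEquiv (TangentBundle I M) (E × E) :=
  extChartAt I.tangent (⟨x₀, 0⟩ : TangentBundle I M)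

variable {I}

theorem tangentChart_fst (x₀ : M) (v : TangentBundle I M) :
    (tangentChart I x₀ v).1 = extChartAt I x₀ v.proj := rfl

theorem tangentChart_snd (x₀ : M) (v : TangentBundle I M) (hv : v.proj ∈ (extChartAt I x₀).source) :
    (tangentChart I x₀ v).2 = mfderiv I 𝓘(ℝ, E) (extChartAt I x₀) v.proj v.2 := by
  rw [extChartAt_source] at hv
  have : IsManifold I 1 M := .of_le (n := ∞) (by simp)
  have h := Bundle.Trivialization.continuousLinearMapAt_apply_of_mem (R := ℝ)
    (trivializationAt E (TangentSpace I) x₀) (by simpa using hv) v.2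
  rw [TangentBundle.continuousLinearMapAt_trivializationAt hv] at h
  exact h.symm

theorem tangentChart_source (x₀ : M) :
    (tangentChart I x₀).source = {v | v.proj ∈ (extChartAt I x₀).source} := by
  ext v
  rw [tangentChart, extChartAt_source, extChartAt_source, mem_ofPred_eq, TangentBundle.mem_chart_source_iff]

theorem tangentChart_target [I.Boundaryless] (x₀ : M) :
    (tangentChart I x₀).target = {p | p.1 ∈ (extChartAt I x₀).target} := by
  ext p
  rw [tangentChart, extChartAt_target, extChartAt_target]
  simp only [ModelWithCorners.range_eq_univ, inter_univ, mem_preimage, mem_ofPred_eq]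
  rw [TangentBundle.mem_chart_target_iff]
  rfl

theorem eta_eq [I.Boundaryless] {π : M → ℝ} (hπ : IsFibration I π) (x₀ : M) (v : TangentBundle I M)
    (hv : v.proj ∈ (extChartAt I x₀).source) :
    eta I π v = fibreMap I π x₀ (tangentChart I x₀ v).1 (tangentChart I x₀ v).2 := by
  have : IsManifold I 1 M := .of_le (n := ∞) (by simp)
  rw [tangentChart_snd x₀ v hv, tangentChart_fst, eta, fibreMap, ← mfderiv_eq_fderiv]
  have h1 : MDifferentiableAt I 𝓘(ℝ, E) (extChartAt I x₀) v.proj :=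
    mdifferentiableAt_extChartAt (by simpa using hv)
  have h2 : MDifferentiableAt 𝓘(ℝ, E) 𝓘(ℝ, ℝ) (π ∘ (extChartAt I x₀).symm) (extChartAt I x₀ v.proj) := by
    have := (contMDiffOn_extChartAt_symm (I := I) (n := ∞) x₀).contMDiffAt
      ((isOpen_extChartAt_target x₀).mem_nhds ((extChartAt I x₀).map_source hv))
    exact (hπ.smooth.contMDiffAt.comp _ this).mdifferentiableAt (by simp)
  have h3 : mfderiv I 𝓘(ℝ, ℝ) π v.proj =
      mfderiv I 𝓘(ℝ, ℝ) ((π ∘ (extChartAt I x₀).symm) ∘ extChartAt I x₀) v.proj := by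
    apply Filter.EventuallyEq.mfderiv_eq
    filter_upwards [extChartAt_source_mem_nhds' hv] with z hz
    rw [Function.comp_apply, Function.comp_apply, (extChartAt I x₀).left_inv hz]
  rw [h3, mfderiv_comp _ h2 h1]
  rfl

theorem contDiffOn_fibreMap [I.Boundaryless] {π : M → ℝ} (hπ : IsFibration I π) (x₀ : M) :
    ContDiffOn ℝ ∞ (fibreMap I π x₀) (extChartAt I x₀).target := by
  have : ContDiffOn ℝ ∞ (π ∘ (extChartAt I x₀).symm) (extChartAt I x₀).target :=
    (hπ.smooth.comp_contMDiffOn (contMDiffOn_extChartAt_symm x₀)).contDiffOn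
  exact this.fderiv_of_isOpen (isOpen_extChartAt_target x₀) (by simp)

variable [FiniteDimensional ℝ E]

theorem exists_prod_isInvertible (f : E →L[ℝ] ℝ) (hf : Function.Surjective f) :
    ∃ P : E →L[ℝ] JetFibre E, (f.prod P).IsInvertible := by
  have hrk : Module.finrank ℝ f.toLinearMap.ker + 1 = Module.finrank ℝ E := by
    have h := f.toLinearMap.finrank_range_add_finrank_ker
    have h' : f.toLinearMap.range = ⊤ := LinearMap.range_eq_top.2 hf
    rw [h', finrank_top, Module.finrank_self] at h
    omega
  have hk : Module.finrank ℝ f.toLinearMap.ker = Module.finrank ℝ (JetFibre E) := by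
    rw [finrank_euclideanSpace_fin]
    omega
  obtain ⟨p, hp⟩ := f.toLinearMap.ker.subtype.exists_leftInverse_of_injective
    (Submodule.ker_subtype _)
  let e := LinearEquiv.ofFinrankEq _ _ hk
  let P : E →L[ℝ] JetFibre E := LinearMap.toContinuousLinearMap (e.toLinearMap ∘ₗ p)
  refine ⟨P, ?_⟩
  have hinj : Function.Injective (f.prod P).toLinearMap := by
    rw [← LinearMap.ker_eq_bot, LinearMap.ker_eq_bot']
    intro x hx
    have h1 : f x = 0 := congrArg Prod.fst hx
    have h2 : e (p x) = 0 := congrArg Prod.snd hx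
    have h3 : p x = 0 := by simpa using h2
    have h4 := LinearMap.congr_fun hp ⟨x, h1⟩
    have h5 : p x = ⟨x, h1⟩ := h4
    rw [h3] at h5
    exact (congrArg Subtype.val h5).symm
  have hdim : Module.finrank ℝ E = Module.finrank ℝ (ℝ × JetFibre E) := by
    rw [Module.finrank_prod, Module.finrank_self, finrank_euclideanSpace_fin]
    omega
  refine ⟨(LinearEquiv.ofInjectiveOfFinrankEq _ hinj hdim).toContinuousLinearEquiv, ?_⟩
  ext x <;> rfl

variable [I.Boundaryless] {π : M → ℝ}

theorem fibreMap_surjective (hπ : IsFibration I π) (x₀ : M) :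
    Function.Surjective (fibreMap I π x₀ (extChartAt I x₀ x₀)) := by
  obtain ⟨w, hw⟩ := hπ.submersion x₀ (1 : ℝ)
  have h := eta_eq hπ x₀ ⟨x₀, w⟩ (mem_extChartAt_source x₀)
  intro r
  refine ⟨r • (tangentChart I x₀ ⟨x₀, w⟩).2, ?_⟩
  have h' : eta I π ⟨x₀, w⟩ = 1 := hw
  rw [map_smul, ← tangentChart_fst (I := I) x₀ ⟨x₀, w⟩, ← h, h', smul_eq_mul, mul_one]

/-- A linear map completing `η` at `x₀` to an isomorphism `E ≃ ℝ × ℝⁿ`. -/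
def complement (hπ : IsFibration I π) (x₀ : M) : E →L[ℝ] JetFibre E :=
  (exists_prod_isInvertible _ (fibreMap_surjective hπ x₀)).choose

def frame (hπ : IsFibration I π) (x₀ : M) (y : E) : E →L[ℝ] ℝ × JetFibre E :=
  (fibreMap I π x₀ y).prod (complement hπ x₀)

theorem isInvertible_frame (hπ : IsFibration I π) (x₀ : M) :
    (frame hπ x₀ (extChartAt I x₀ x₀)).IsInvertible :=
  (exists_prod_isInvertible _ (fibreMap_surjective hπ x₀)).choose_spec

def domain (hπ : IsFibration I π) (x₀ : M) : Set E :=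
  {y | y ∈ (extChartAt I x₀).target ∧ (frame hπ x₀ y).IsInvertible}

theorem contDiffOn_frame (hπ : IsFibration I π) (x₀ : M) :
    ContDiffOn ℝ ∞ (frame hπ x₀) (extChartAt I x₀).target := by
  have h := ((contDiffOn_const (c := ContinuousLinearMap.inl ℝ ℝ (JetFibre E))).clm_comp
    (contDiffOn_fibreMap hπ x₀)).add
    (contDiffOn_const (c := (ContinuousLinearMap.inr ℝ ℝ (JetFibre E)).comp (complement hπ x₀)))
  refine h.congr fun y _ => ?_
  ext x <;> simp [frame]

theorem isOpen_domain (hπ : IsFibration I π) (x₀ : M) : IsOpen (domain hπ x₀) := by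
  have : CompleteSpace E := FiniteDimensional.complete ℝ E
  exact (contDiffOn_frame hπ x₀).continuousOn.isOpen_inter_preimage
    (isOpen_extChartAt_target x₀) (ContinuousLinearEquiv.isOpen (𝕜 := ℝ))

def velocity (hπ : IsFibration I π) (x₀ : M) (p : E × JetFibre E) : E × E :=
  (p.1, (frame hπ x₀ p.1).inverse (1, p.2))

theorem contDiffOn_velocity (hπ : IsFibration I π) (x₀ : M) :
    ContDiffOn ℝ ∞ (velocity hπ x₀) {p | p.1 ∈ domain hπ x₀} := by
  have : CompleteSpace E := FiniteDimensional.complete ℝ E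
  have h1 : ContDiffOn ℝ ∞ (fun p : E × JetFibre E => (frame hπ x₀ p.1).inverse)
      {p | p.1 ∈ domain hπ x₀} := by
    intro p hp
    obtain ⟨e, he⟩ := hp.2
    have h2 : ContDiffAt ℝ ∞ (frame hπ x₀) p.1 :=
      (contDiffOn_frame hπ x₀).contDiffAt ((isOpen_extChartAt_target x₀).mem_nhds hp.1)
    have h3 : ContDiffAt ℝ ∞ ContinuousLinearMap.inverse (frame hπ x₀ p.1) := by
      rw [← he]; exact contDiffAt_map_inverse e
    exact (h3.comp p (h2.comp p contDiffAt_fst)).contDiffWithinAt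
  exact contDiffOn_fst.prodMk (h1.clm_apply (contDiffOn_const.prodMk contDiffOn_snd))

theorem tangentChart_mem (x₀ : M) {v : TangentBundle I M} (hv : v.proj ∈ (extChartAt I x₀).source) :
    v ∈ (tangentChart I x₀).source := by rw [tangentChart_source]; exact hv

theorem velocity_mem (hπ : IsFibration I π) (x₀ : M) {p : E × JetFibre E}
    (hp : p.1 ∈ domain hπ x₀) : velocity hπ x₀ p ∈ (tangentChart I x₀).target := by
  rw [tangentChart_target]; exact hp.1

/-- The inverse of the chart, with values in `TM`. -/
def lift (hπ : IsFibration I π) (x₀ : M) (p : E × JetFibre E) : TangentBundle I M :=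
  (tangentChart I x₀).symm (velocity hπ x₀ p)

theorem lift_proj_mem (hπ : IsFibration I π) (x₀ : M) {p : E × JetFibre E}
    (hp : p.1 ∈ domain hπ x₀) : (lift hπ x₀ p).proj ∈ (extChartAt I x₀).source := by
  have h := (tangentChart I x₀).map_target (velocity_mem hπ x₀ hp)
  rwa [tangentChart_source] at h

theorem tangentChart_lift (hπ : IsFibration I π) (x₀ : M) {p : E × JetFibre E}
    (hp : p.1 ∈ domain hπ x₀) : tangentChart I x₀ (lift hπ x₀ p) = velocity hπ x₀ p :=
  (tangentChart I x₀).right_inv (velocity_mem hπ x₀ hp)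

theorem eta_lift (hπ : IsFibration I π) (x₀ : M) {p : E × JetFibre E}
    (hp : p.1 ∈ domain hπ x₀) : eta I π (lift hπ x₀ p) = 1 := by
  rw [eta_eq hπ x₀ _ (lift_proj_mem hπ x₀ hp), tangentChart_lift hπ x₀ hp]
  exact congrArg Prod.fst (hp.2.self_apply_inverse (1, p.2))

/-- The chart, as a function on `TM`. -/
def coord (hπ : IsFibration I π) (x₀ : M) (v : TangentBundle I M) : E × JetFibre E :=
  ((tangentChart I x₀ v).1, complement hπ x₀ (tangentChart I x₀ v).2)

theorem coord_lift (hπ : IsFibration I π) (x₀ : M) {p : E × JetFibre E}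
    (hp : p.1 ∈ domain hπ x₀) : coord hπ x₀ (lift hπ x₀ p) = p := by
  rw [coord, tangentChart_lift hπ x₀ hp]
  exact Prod.ext rfl (congrArg (fun q => q.2) (hp.2.self_apply_inverse (1, p.2)))

theorem lift_coord (hπ : IsFibration I π) (x₀ : M) {v : TangentBundle I M}
    (hv : v.proj ∈ (extChartAt I x₀).source)
    (hv' : extChartAt I x₀ v.proj ∈ domain hπ x₀) (h1 : eta I π v = 1) :
    lift hπ x₀ (coord hπ x₀ v) = v := by
  have h : velocity hπ x₀ (coord hπ x₀ v) = tangentChart I x₀ v := by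
    refine Prod.ext rfl ?_
    rw [eta_eq hπ x₀ v hv] at h1
    have h2 : (1, complement hπ x₀ (tangentChart I x₀ v).2) =
        frame hπ x₀ (tangentChart I x₀ v).1 (tangentChart I x₀ v).2 := Prod.ext h1.symm rfl
    change (frame hπ x₀ (tangentChart I x₀ v).1).inverse
      (1, complement hπ x₀ (tangentChart I x₀ v).2) = _
    rw [h2]
    exact hv'.2.inverse_apply_self _
  rw [lift, h]
  exact (tangentChart I x₀).left_inv (tangentChart_mem x₀ hv)

end JetChart

variable {I}
variable [FiniteDimensional ℝ E] [I.Boundaryless] {π : M → ℝ}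

/-- The manifold `J¹π` of 1-jets of local sections of `π : M → ℝ`. The jet at `π x` of a local section
`σ` through `x` is identified with the velocity of `σ`, so that `J¹π` is the embedded submanifold
`{v ∈ TM | η(v) = 1}` of `TM`; `incl` is the inclusion. -/
structure JetBundle (hπ : IsFibration I π) where
  incl : TangentBundle I M
  eta_incl : eta I π incl = 1

namespace JetBundle
variable (hπ : IsFibration I π)

instance : TopologicalSpace (JetBundle hπ) := TopologicalSpace.induced incl inferInstance

theorem incl_injective : Function.Injective (incl : JetBundle hπ → TangentBundle I M) := by
  rintro ⟨v, _⟩ ⟨w, _⟩ rfl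
  rfl

open JetChart

/-- Some point of `J¹π` over `x₀`. -/
def base (x₀ : M) : JetBundle hπ :=
  ⟨⟨x₀, (hπ.submersion x₀ (1 : ℝ)).choose⟩, (hπ.submersion x₀ (1 : ℝ)).choose_spec⟩

open Classical in
def ofCoord (x₀ : M) (p : E × JetFibre E) : JetBundle hπ :=
  if h : eta I π (lift hπ x₀ p) = 1 then ⟨lift hπ x₀ p, h⟩ else base hπ x₀

theorem incl_ofCoord (x₀ : M) {p : E × JetFibre E} (hp : p.1 ∈ domain hπ x₀) :
    incl (ofCoord hπ x₀ p) = lift hπ x₀ p := by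
  rw [ofCoord, dif_pos (eta_lift hπ x₀ hp)]

theorem isInducing_incl : Topology.IsInducing (incl : JetBundle hπ → TangentBundle I M) := ⟨rfl⟩

/-- The chart of `J¹π` over (a neighbourhood of `x₀` in) the chart of `M` at `x₀`. -/
def chart (x₀ : M) : OpenPartialHomeomorph (JetBundle hπ) (E × JetFibre E) where
  toFun v := coord hπ x₀ (incl v)
  invFun := ofCoord hπ x₀
  source := {v | (incl v).proj ∈ (extChartAt I x₀).source ∧
    extChartAt I x₀ (incl v).proj ∈ domain hπ x₀}
  target := {p | p.1 ∈ domain hπ x₀}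
  map_source' _ hv := hv.2
  map_target' p hp := by
    rw [mem_ofPred_eq, incl_ofCoord hπ x₀ hp]
    refine ⟨lift_proj_mem hπ x₀ hp, ?_⟩
    rw [← tangentChart_fst, tangentChart_lift hπ x₀ hp]
    exact hp
  left_inv' v hv := by
    apply incl_injective hπ
    rw [incl_ofCoord hπ x₀ hv.2]
    exact lift_coord hπ x₀ hv.1 hv.2 v.eta_incl
  right_inv' p hp := by
    rw [incl_ofCoord hπ x₀ hp]
    exact coord_lift hπ x₀ hp
  open_source := by
    have hc : Continuous fun v : JetBundle hπ => (incl v).proj :=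
      (FiberBundle.continuous_proj E (TangentSpace I)).comp (isInducing_incl hπ).continuous
    exact ((continuousOn_extChartAt x₀).isOpen_inter_preimage (isOpen_extChartAt_source x₀)
      (isOpen_domain hπ x₀)).preimage hc
  open_target := (isOpen_domain hπ x₀).preimage continuous_fst
  continuousOn_toFun := by
    have h1 : ContinuousOn (fun v : JetBundle hπ => tangentChart I x₀ (incl v))
        {v | (incl v).proj ∈ (extChartAt I x₀).source ∧
          extChartAt I x₀ (incl v).proj ∈ domain hπ x₀} :=
      (continuousOn_extChartAt (I := I.tangent) (⟨x₀, 0⟩ : TangentBundle I M)).comp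
        (isInducing_incl hπ).continuous.continuousOn fun v hv => tangentChart_mem x₀ hv.1
    exact (continuous_fst.comp_continuousOn h1).prodMk
      ((complement hπ x₀).continuous.comp_continuousOn (continuous_snd.comp_continuousOn h1))
  continuousOn_invFun := by
    rw [(isInducing_incl hπ).continuousOn_iff]
    have h1 : ContinuousOn (lift hπ x₀) {p | p.1 ∈ domain hπ x₀} :=
      (continuousOn_extChartAt_symm (I := I.tangent) (⟨x₀, 0⟩ : TangentBundle I M)).comp
        (contDiffOn_velocity hπ x₀).continuousOn fun p hp => velocity_mem hπ x₀ hp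
    exact h1.congr fun p hp => incl_ofCoord hπ x₀ hp

instance : ChartedSpace (E × JetFibre E) (JetBundle hπ) where
  atlas := range (chart hπ)
  chartAt v := chart hπ (incl v).proj
  mem_chart_source _ := ⟨mem_extChartAt_source _, mem_extChartAt_target _, isInvertible_frame hπ _⟩
  chart_mem_atlas _ := mem_range_self _

instance : IsManifold 𝓘(ℝ, E × JetFibre E) ∞ (JetBundle hπ) := by
  apply isManifold_of_contDiffOn
  rintro _ _ ⟨x, rfl⟩ ⟨x', rfl⟩
  have h1 : ContDiffOn ℝ ∞ (tangentChart I x' ∘ (tangentChart I x).symm)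
      ((tangentChart I x).symm ≫ tangentChart I x').source :=
    contDiffOn_ext_coord_change (I := I.tangent) _ _
  have h2 : ContDiffOn ℝ ∞ (fun p => tangentChart I x' (lift hπ x p))
      ((chart hπ x).symm ≫ₕ chart hπ x').source := by
    refine h1.comp ((contDiffOn_velocity hπ x).mono fun p hp => hp.1) fun p hp => ?_
    refine ⟨velocity_mem hπ x hp.1, tangentChart_mem x' ?_⟩
    have := hp.2.1
    change (incl (ofCoord hπ x p)).proj ∈ _ at this
    rwa [incl_ofCoord hπ x hp.1] at this
  have h3 : ContDiffOn ℝ ∞ (fun p => coord hπ x' (lift hπ x p))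
      ((chart hπ x).symm ≫ₕ chart hπ x').source :=
    h2.fst.prodMk ((complement hπ x').contDiff.comp_contDiffOn h2.snd)
  simp only [modelWithCornersSelf_coe, modelWithCornersSelf_coe_symm, range_id, preimage_id,
    inter_univ, Function.id_comp, Function.comp_id]
  refine h3.congr fun p hp => ?_
  change coord hπ x' (incl (ofCoord hπ x p)) = _
  rw [incl_ofCoord hπ x hp.1]


end JetBundle
end

section

variable {E : Type*} [NormedAddCommGroup E] [NormedSpace ℝ E] {H : Type*} [TopologicalSpace H]
  (I : ModelWithCorners ℝ E H) {M : Type*} [TopologicalSpace M] [ChartedSpace H M]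
  {E' : Type*} [NormedAddCommGroup E'] [NormedSpace ℝ E'] {H' : Type*} [TopologicalSpace H']
  (I' : ModelWithCorners ℝ E' H') {M' : Type*} [TopologicalSpace M'] [ChartedSpace H' M']

/-- Differential `k`-forms on `M` (smoothness is `DiffForm.IsSmooth`). -/
abbrev DiffForm (M : Type*) [TopologicalSpace M] [ChartedSpace H M] (k : ℕ) : Type _ :=
  ∀ x : M, TangentSpace I x [⋀^Fin k]→L[ℝ] ℝ

namespace DiffForm
variable {I I'} {k : ℕ}

/-- The coordinate expression of a form in the chart of `M` at `x₀`. -/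
def inChart (Ω : DiffForm I M k) (x₀ : M) (y : E) : E [⋀^Fin k]→L[ℝ] ℝ :=
  (Ω ((extChartAt I x₀).symm y)).compContinuousLinearMap
    (mfderivWithin 𝓘(ℝ, E) I (extChartAt I x₀).symm (range I) y)

def IsSmooth (Ω : DiffForm I M k) : Prop :=
  ∀ x₀ : M, ContDiffOn ℝ ∞ (Ω.inChart x₀) (extChartAt I x₀).target

/-- The exterior derivative, computed at each point `x` in the chart at `x`. -/
def d (Ω : DiffForm I M k) : DiffForm I M (k + 1) := fun x =>
  ContinuousAlternatingMap.compContinuousLinearMap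
    (extDerivWithin (Ω.inChart x) (range I) (extChartAt I x x))
    (mfderiv I 𝓘(ℝ, E) (extChartAt I x) x)

/-- The pullback `f^* Ω`. -/
def pullback (f : M → M') (Ω : DiffForm I' M' k) : DiffForm I M k := fun x =>
  (Ω (f x)).compContinuousLinearMap (mfderiv I I' f x)

/-- A presymplectic form: a smooth closed 2-form. -/
def IsPresymplectic (Ω : DiffForm I M 2) : Prop := Ω.IsSmooth ∧ Ω.d = 0

/-- `f : (M, Ω) → (M', Ω')` is a presymplectic map between presymplectic manifolds: it is smooth and
`f^* Ω' = Ω`. -/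
structure IsPresymplecticMap (Ω : DiffForm I M 2) (Ω' : DiffForm I' M' 2) (f : M → M') : Prop where
  source : Ω.IsPresymplectic
  target : Ω'.IsPresymplectic
  smooth : ContMDiff I I' ∞ f
  pullback_eq : Ω'.pullback f = Ω

/-- The contraction `i_T Ω`, a form on `TM`:
`(i_T Ω)_v (ξ₁, …, ξ_k) = Ω (v, Tτ ξ₁, …, Tτ ξ_k)` with `τ : TM → M` the projection. -/
def contractT [IsManifold I 1 M] (Ω : DiffForm I M (k + 1)) :
    DiffForm I.tangent (TangentBundle I M) k := fun v =>
  ContinuousAlternatingMap.compContinuousLinearMap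
    (ContinuousAlternatingMap.curryLeft (E := E) (Ω v.proj) v.2)
    (mfderiv I.tangent I (Bundle.TotalSpace.proj : TangentBundle I M → M) v)

/-- The complete lift `Ω^c = i_T dΩ + d (i_T Ω)` of a form on `M` to `TM`. In the coordinates `(x, v)` of
`TM` induced by coordinates `x` of `M`, it is obtained by applying to `Ω` the derivation that maps
`f(x)` to `v^i ∂f/∂x^i` and `dx^i` to `dv^i`. -/
def completeLift [IsManifold I 1 M] (Ω : DiffForm I M (k + 1)) :
    DiffForm I.tangent (TangentBundle I M) (k + 1) :=
  Ω.d.contractT + Ω.contractT.d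
end DiffForm

end

section

variable {E : Type*} [NormedAddCommGroup E] [NormedSpace ℝ E] {H : Type*} [TopologicalSpace H]
  (I : ModelWithCorners ℝ E H) (M : Type*) [TopologicalSpace M] [ChartedSpace H M]
  [IsManifold I ∞ M]

/-- The cotangent bundle `T*M`, with the manifold structure of a vector bundle. -/
abbrev CotangentBundle : Type _ :=
  Bundle.TotalSpace (E →L[ℝ] ℝ) (fun x : M => TangentSpace I x →L[ℝ] Bundle.Trivial M ℝ x)

/-- The model with corners of `T*M`. -/
abbrev cotangentModel : ModelWithCorners ℝ (E × (E →L[ℝ] ℝ)) (ModelProd H (E →L[ℝ] ℝ)) :=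
  I.prod 𝓘(ℝ, E →L[ℝ] ℝ)

variable {M}

/-- The projection `π_M : T*M → M`. -/
def CotangentBundle.proj : CotangentBundle I M → M := Bundle.TotalSpace.proj

/-- The Liouville form of `T*M`: `θ_α(u) = α(Tπ_M u)`, locally `p_i dq^i`. -/
def liouvilleForm : DiffForm (cotangentModel I) (CotangentBundle I M) 1 := fun α =>
  ContinuousAlternatingMap.ofSubsingleton ℝ _ ℝ 0
    (ContinuousLinearMap.comp (M₂ := TangentSpace I α.proj) (M₃ := ℝ) α.2
      (mfderiv (cotangentModel I) I (CotangentBundle.proj I) α))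

/-- The canonical symplectic form `-dθ` of `T*M`, locally `dq^i ∧ dp_i`. -/
def canonicalForm : DiffForm (cotangentModel I) (CotangentBundle I M) 2 :=
  -(liouvilleForm I).d

/-- The canonical Tulczyjew diffeomorphism `A_M : T(T*M) → T*(TM)`, locally
`(q, p; q̇, ṗ) ↦ (q, q̇; ṗ, p)`, that is, the covector `(a, b) ↦ ṗ(a) + p(b)` at `(q, q̇)`.
The local formula does not depend on the chart of `M`, and is written here in the chart at the base
point `q`: a tangent vector of `T*M` at `(q, p)` is by definition the pair `(q̇, ṗ)` of its components
in the chart of `T*M` induced by the chart at `q`, and likewise for `TM` at `(q, q̇)`. -/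
def tulczyjew (z : TangentBundle (cotangentModel I) (CotangentBundle I M)) :
    CotangentBundle I.tangent (TangentBundle I M) :=
  let q : M := z.proj.proj
  let p : E →L[ℝ] ℝ := z.proj.2
  let qdot : E := z.2.1
  let pdot : E →L[ℝ] ℝ := z.2.2
  ⟨⟨q, qdot⟩, (pdot.coprod p : E × E →L[ℝ] ℝ)⟩

variable {I}

theorem mfderiv_cotangentProj (α : CotangentBundle I M) :
    mfderiv (cotangentModel I) I (CotangentBundle.proj I) α =
      (ContinuousLinearMap.fst ℝ E (E →L[ℝ] ℝ)) := by
  have hc : ContinuousAt (CotangentBundle.proj I) α := (FiberBundle.continuous_proj (E →L[ℝ] ℝ)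
    (fun x : M => TangentSpace I x →L[ℝ] Bundle.Trivial M ℝ x)).continuousAt
  have he : ∀ y ∈ (extChartAt (cotangentModel I) α).target,
      writtenInExtChartAt (cotangentModel I) I α (CotangentBundle.proj I) y = y.1 := by
    intro y hy
    exact congrArg Prod.fst ((extChartAt (cotangentModel I) α).right_inv hy)
  have h : HasMFDerivAt (cotangentModel I) I (CotangentBundle.proj I) α
      (ContinuousLinearMap.fst ℝ E (E →L[ℝ] ℝ)) :=
    ⟨hc, hasFDerivWithinAt_fst.congr_of_eventuallyEq
      (Filter.eventuallyEq_of_mem (extChartAt_target_mem_nhdsWithin α) he)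
      (he _ (mem_extChartAt_target α))⟩
  exact h.mfderiv

variable {π : M → ℝ}

theorem mfderiv_comp_cotangentProj (hπ : IsFibration I π) (α : CotangentBundle I M)
    (u : TangentSpace (cotangentModel I) α) :
    mfderiv (cotangentModel I) 𝓘(ℝ, ℝ) (π ∘ CotangentBundle.proj I) α u =
      mfderiv I 𝓘(ℝ, ℝ) π α.proj (u : E × (E →L[ℝ] ℝ)).1 := by
  have h := mfderiv_comp (f := CotangentBundle.proj I) α (hπ.smooth.mdifferentiable (by simp) _)
    ((Bundle.contMDiff_proj (n := 1) (IB := I)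
      (fun x : M => TangentSpace I x →L[ℝ] Bundle.Trivial M ℝ x) α).mdifferentiableAt (by simp))
  rw [mfderiv_cotangentProj] at h
  exact DFunLike.congr_fun h u

/-- The projection `π̃_M = π ∘ π_M : T*M → ℝ` is a fibration. -/
theorem IsFibration.cotangent (hπ : IsFibration I π) :
    IsFibration (cotangentModel I) (π ∘ CotangentBundle.proj I) where
  smooth := hπ.smooth.comp (Bundle.contMDiff_proj _)
  surjective := hπ.surjective.comp fun x => ⟨⟨x, 0⟩, rfl⟩
  submersion α := by
    intro r
    obtain ⟨w, hw⟩ := hπ.submersion α.proj r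
    exact ⟨((w, 0) : E × (E →L[ℝ] ℝ)), (mfderiv_comp_cotangentProj hπ α _).trans hw⟩


variable [FiniteDimensional ℝ E] [I.Boundaryless]

/-- The jet prolongation `j¹π_M : J¹π̃_M → J¹π` of `π_M : T*M → M`, where `π̃_M = π ∘ π_M`. It is the
restriction of `Tπ_M` (see `JetBundle.incl_cotangentProj`), and maps `z` to the base point of `A_M(j(z))`. -/
def JetBundle.cotangentProj (hπ : IsFibration I π) (z : JetBundle hπ.cotangent) : JetBundle hπ where
  incl := (tulczyjew I z.incl).proj
  eta_incl := (mfderiv_comp_cotangentProj hπ _ _).symm.trans z.eta_incl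

set_option linter.unusedSectionVars false in
theorem JetBundle.incl_cotangentProj (hπ : IsFibration I π) (z : JetBundle hπ.cotangent) :
    (JetBundle.cotangentProj hπ z).incl =
      tangentMap (cotangentModel I) I (CotangentBundle.proj I) z.incl := by
  rw [tangentMap, mfderiv_cotangentProj]
  rfl

/-- For `z : J¹π̃_M` this is `A_M(j(z))` restricted to `T_v(J¹π) ⊆ T_v(TM)`, `v = j¹π_M(z)`: the canonical
Tulczyjew fibration `J¹π̃_M → T*(J¹π)`. -/
def tulczyjewFibration (hπ : IsFibration I π) (z : JetBundle hπ.cotangent) :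
    CotangentBundle 𝓘(ℝ, E × JetFibre E) (JetBundle hπ) where
  proj := JetBundle.cotangentProj hπ z
  snd := ContinuousLinearMap.comp
    (M₂ := TangentSpace I.tangent (tulczyjew I z.incl).proj) (M₃ := ℝ) (tulczyjew I z.incl).2
    (mfderiv 𝓘(ℝ, E × JetFibre E) I.tangent (JetBundle.incl : JetBundle hπ → TangentBundle I M)
      (JetBundle.cotangentProj hπ z))

/-- The form `j^*(Ω_M^c)` on `J¹π̃_M`, with `j : J¹π̃_M → T(T*M)` the inclusion. -/
def jetPresymplecticForm (hπ : IsFibration I π) :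
    DiffForm 𝓘(ℝ, (E × (E →L[ℝ] ℝ)) × JetFibre (E × (E →L[ℝ] ℝ))) (JetBundle hπ.cotangent) 2 :=
  (canonicalForm I).completeLift.pullback JetBundle.incl
end

end

/-!
Write `θ_N` for the Liouville form of `T*N`, so that `Ω_N = -dθ_N`. The theorem is the exterior
derivative of an identity between 1-forms.

The complete lift of `θ_M` is `θ_M^c = i_T dθ_M + d(i_T θ_M)`. At `z = (q, p; q̇, ṗ)` the first summand is
`ṗ dq - q̇ dp` and the second is `d(p q̇)`, so that `θ_M^c = ṗ dq + p dq̇`. This is the covector `A_M(z)`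
pulled back along `Tπ_M : (q, p; q̇, ṗ) ↦ (q, q̇)`, which is the composition of `A_M` with the projection to
`TM` (`liouvilleForm_completeLift_eq`). Restricting along `j : J¹π̃_M → T(T*M)` and using
`incl ∘ j¹π_M = Tπ_M ∘ j` gives `Ã_π^* θ_{J¹π} = j^*(θ_M^c)`
(`pullback_liouvilleForm_tulczyjewFibration`).

The complete lift commutes with `d` because `d² = 0` (`DiffForm.IsSmooth.completeLift_d`). Hence
`j^*(Ω_M^c) = -d(j^*θ_M^c) = -d(Ã_π^* θ_{J¹π}) = Ã_π^* Ω_{J¹π}`. Both 2-forms are exact, with smooth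
potentials, so they are smooth and closed.

The identities between forms are verified at a point `x` in the chart at `x`, in which the
components of tangent vectors are by definition the coordinates. The general facts about `d` (it may
be computed in any chart, squares to zero and commutes with pullbacks) reduce to their counterparts
for forms on vector spaces.

The smoothness of `A_M` follows from the same identity: `A_M` is a field of covectors along the
submersion `Tπ_M`, and its pullback `θ_M^c` is a smooth 1-form, which makes it smooth
(`contMDiffAt_cotangentBundle_of_pullback`). No transformation law for `A_M` under changes of charts
is needed. Then `Ã_π` is smooth as the restriction of `A_M` along the smooth inclusion of `J¹π`.
-/

noncomputable section

section

variable {E : Type*} [NormedAddCommGroup E] [NormedSpace ℝ E] {H : Type*} [TopologicalSpace H]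
  {I : ModelWithCorners ℝ E H} {M : Type*} [TopologicalSpace M] [ChartedSpace H M]
  {E' : Type*} [NormedAddCommGroup E'] [NormedSpace ℝ E'] {H' : Type*} [TopologicalSpace H']
  {I' : ModelWithCorners ℝ E' H'} {M' : Type*} [TopologicalSpace M'] [ChartedSpace H' M']

/-! ### Differential forms in charts -/

theorem minSmoothness_two_le_infty : minSmoothness ℝ 2 ≤ (∞ : WithTop ℕ∞) := by
  rw [minSmoothness_of_isRCLikeNormedField]
  exact WithTop.coe_le_coe.2 le_top

theorem mdifferentiableAt_extChartAt_symm [I.Boundaryless] [IsManifold I ∞ M] (x₀ : M) {y : E}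
    (hy : y ∈ (extChartAt I x₀).target) :
    MDifferentiableAt 𝓘(ℝ, E) I (extChartAt I x₀).symm y := by
  have h := mdifferentiableWithinAt_extChartAt_symm (I := I) hy
  rwa [I.range_eq_univ, mdifferentiableWithinAt_univ] at h

namespace DiffForm

variable {k : ℕ}

/-- All fibres of a form are alternating maps on the model space `E`, so that the values of a form at
equal points can be compared on the same vectors. -/
theorem apply_congr (Ω : DiffForm I M k) {x x' : M} (h : x = x') (v : Fin k → E) :
    (Ω x : E [⋀^Fin k]→L[ℝ] ℝ) v = (Ω x' : E [⋀^Fin k]→L[ℝ] ℝ) v := by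
  subst h; rfl

theorem inChart_neg (Ω : DiffForm I M k) (x₀ : M) : (-Ω).inChart x₀ = -Ω.inChart x₀ := by
  funext y
  ext v
  rfl

theorem inChart_add (Ω Ω' : DiffForm I M k) (x₀ : M) :
    (Ω + Ω').inChart x₀ = Ω.inChart x₀ + Ω'.inChart x₀ := by
  funext y
  ext v
  rfl

theorem IsSmooth.neg {Ω : DiffForm I M k} (hΩ : Ω.IsSmooth) : (-Ω).IsSmooth := fun x₀ => by
  rw [inChart_neg]
  exact (hΩ x₀).neg

theorem IsSmooth.add {Ω Ω' : DiffForm I M k} (hΩ : Ω.IsSmooth) (hΩ' : Ω'.IsSmooth) :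
    (Ω + Ω').IsSmooth := fun x₀ => by
  rw [inChart_add]
  exact (hΩ x₀).add (hΩ' x₀)

theorem inChart_apply [I.Boundaryless] (Ω : DiffForm I M k) (x₀ : M) (y : E) (v : Fin k → E) :
    Ω.inChart x₀ y v = (Ω ((extChartAt I x₀).symm y) : E [⋀^Fin k]→L[ℝ] ℝ)
      (fun i => (mfderiv 𝓘(ℝ, E) I (extChartAt I x₀).symm y : E →L[ℝ] E) (v i)) := by
  rw [← mfderivWithin_univ, ← I.range_eq_univ]
  rfl

theorem pullback_apply (Ω : DiffForm I' M' k) (f : M → M') (x : M) (v : Fin k → E) :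
    (Ω.pullback f : DiffForm I M k) x v =
      (Ω (f x) : E' [⋀^Fin k]→L[ℝ] ℝ) (fun i => (mfderiv I I' f x : E →L[ℝ] E') (v i)) := rfl

variable [I.Boundaryless]

theorem eventually_chart_comp_mem {f : M → M'} (hf : ContMDiff I I' ∞ f) {x₀ : M} {x₀' : M'} {y : E}
    (hy : y ∈ (extChartAt I x₀).target)
    (hy' : f ((extChartAt I x₀).symm y) ∈ (extChartAt I' x₀').source) :
    ∀ᶠ z in 𝓝 y, z ∈ (extChartAt I x₀).target ∧
      f ((extChartAt I x₀).symm z) ∈ (extChartAt I' x₀').source := by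
  have h1 : ContinuousAt (extChartAt I x₀).symm y :=
    (continuousOn_extChartAt_symm x₀).continuousAt ((isOpen_extChartAt_target x₀).mem_nhds hy)
  have h2 : ContinuousAt (fun z => f ((extChartAt I x₀).symm z)) y :=
    hf.continuous.continuousAt.comp h1
  exact ((isOpen_extChartAt_target x₀).eventually_mem hy).and
    (h2.eventually_mem ((isOpen_extChartAt_source x₀').mem_nhds hy'))

theorem IsSmooth.contDiffAt {Ω : DiffForm I M k} (hΩ : Ω.IsSmooth) {x₀ : M} {y : E}
    (hy : y ∈ (extChartAt I x₀).target) : ContDiffAt ℝ ∞ (Ω.inChart x₀) y :=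
  (hΩ x₀).contDiffAt ((isOpen_extChartAt_target x₀).mem_nhds hy)

theorem IsSmooth.differentiableAt {Ω : DiffForm I M k} (hΩ : Ω.IsSmooth) {x₀ : M} {y : E}
    (hy : y ∈ (extChartAt I x₀).target) : DifferentiableAt ℝ (Ω.inChart x₀) y :=
  (hΩ.contDiffAt hy).differentiableAt (by simp)

variable [IsManifold I ∞ M] [IsManifold I' ∞ M']

/-- The representative of a smooth map in two charts, as a map between vector spaces. -/
theorem contDiffAt_chart_comp {f : M → M'} (hf : ContMDiff I I' ∞ f) {x₀ : M} {x₀' : M'} {y : E}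
    (hy : y ∈ (extChartAt I x₀).target)
    (hy' : f ((extChartAt I x₀).symm y) ∈ (extChartAt I' x₀').source) :
    ContDiffAt ℝ ∞ (extChartAt I' x₀' ∘ f ∘ (extChartAt I x₀).symm) y := by
  rw [← contMDiffAt_iff_contDiffAt]
  have h1 : ContMDiffAt 𝓘(ℝ, E) I ∞ (extChartAt I x₀).symm y :=
    (contMDiffOn_extChartAt_symm x₀).contMDiffAt ((isOpen_extChartAt_target x₀).mem_nhds hy)
  have h2 : ContMDiffAt I' 𝓘(ℝ, E') ∞ (extChartAt I' x₀') (f ((extChartAt I x₀).symm y)) :=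
    contMDiffAt_extChartAt' (by rwa [extChartAt_source] at hy')
  exact h2.comp y (hf.contMDiffAt.comp y h1)

variable [I'.Boundaryless]

/-- The chain rule for `φ'⁻¹ ∘ (φ' ∘ f ∘ φ⁻¹) = f ∘ φ⁻¹`. -/
theorem mfderiv_extChartAt_symm_fderiv_chart_comp {f : M → M'} (hf : ContMDiff I I' ∞ f)
    {x₀ : M} {x₀' : M'} {y : E} (hy : y ∈ (extChartAt I x₀).target)
    (hy' : f ((extChartAt I x₀).symm y) ∈ (extChartAt I' x₀').source) (u : E) :
    (mfderiv 𝓘(ℝ, E') I' (extChartAt I' x₀').symm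
        ((extChartAt I' x₀' ∘ f ∘ (extChartAt I x₀).symm) y) : E' →L[ℝ] E')
      (fderiv ℝ (extChartAt I' x₀' ∘ f ∘ (extChartAt I x₀).symm) y u) =
    (mfderiv I I' f ((extChartAt I x₀).symm y) : E →L[ℝ] E')
      ((mfderiv 𝓘(ℝ, E) I (extChartAt I x₀).symm y : E →L[ℝ] E) u) := by
  set F := extChartAt I' x₀' ∘ f ∘ (extChartAt I x₀).symm with hFdef
  have hF : HasMFDerivAt 𝓘(ℝ, E) 𝓘(ℝ, E') F y (fderiv ℝ F y) :=
    ((contDiffAt_chart_comp hf hy hy').differentiableAt (by simp)).hasFDerivAt.hasMFDerivAt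
  have hs : MDifferentiableAt 𝓘(ℝ, E) I (extChartAt I x₀).symm y :=
    mdifferentiableAt_extChartAt_symm x₀ hy
  have hs' : MDifferentiableAt 𝓘(ℝ, E') I' (extChartAt I' x₀').symm (F y) :=
    mdifferentiableAt_extChartAt_symm x₀' ((extChartAt I' x₀').map_source hy')
  have h1 := (hf.mdifferentiable (by simp) ((extChartAt I x₀).symm y)).hasMFDerivAt.comp y
    hs.hasMFDerivAt
  have h2 := hs'.hasMFDerivAt.comp y hF
  have h3 : (extChartAt I' x₀').symm ∘ F =ᶠ[𝓝 y] f ∘ (extChartAt I x₀).symm := by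
    filter_upwards [eventually_chart_comp_mem hf hy hy'] with z hz
    exact (extChartAt I' x₀').left_inv hz.2
  exact DFunLike.congr_fun (hasMFDerivAt_unique (h2.congr_of_eventuallyEq h3.symm) h1) u

/-- In charts, the pullback of a form by a smooth map is the pullback by its representative. -/
theorem inChart_pullback (Ω : DiffForm I' M' k) {f : M → M'} (hf : ContMDiff I I' ∞ f)
    {x₀ : M} {x₀' : M'} {y : E} (hy : y ∈ (extChartAt I x₀).target)
    (hy' : f ((extChartAt I x₀).symm y) ∈ (extChartAt I' x₀').source) :
    (Ω.pullback f : DiffForm I M k).inChart x₀ y =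
      (Ω.inChart x₀' ((extChartAt I' x₀' ∘ f ∘ (extChartAt I x₀).symm) y)).compContinuousLinearMap
        (fderiv ℝ (extChartAt I' x₀' ∘ f ∘ (extChartAt I x₀).symm) y) := by
  ext v
  refine (inChart_apply _ x₀ y v).trans (Eq.trans ?_ (inChart_apply Ω x₀' _ _).symm)
  refine Eq.trans ?_ (apply_congr Ω ((extChartAt I' x₀').left_inv hy').symm _)
  refine congrArg (Ω (f ((extChartAt I x₀).symm y)) : E' [⋀^Fin k]→L[ℝ] ℝ) ?_
  funext i
  exact (mfderiv_extChartAt_symm_fderiv_chart_comp hf hy hy' (v i)).symm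

/-- The change of charts for the coordinate expressions of a form. -/
theorem inChart_eq_comp (Ω : DiffForm I M k) {x₀ x₀' : M} {y : E}
    (hy : y ∈ (extChartAt I x₀).target) (hy' : (extChartAt I x₀).symm y ∈ (extChartAt I x₀').source) :
    Ω.inChart x₀ y =
      (Ω.inChart x₀' ((extChartAt I x₀' ∘ id ∘ (extChartAt I x₀).symm) y)).compContinuousLinearMap
        (fderiv ℝ (extChartAt I x₀' ∘ id ∘ (extChartAt I x₀).symm) y) := by
  rw [← inChart_pullback Ω contMDiff_id hy hy']
  ext v
  refine (inChart_apply Ω x₀ y v).trans (Eq.trans ?_ (inChart_apply _ x₀ y v).symm)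
  refine Eq.trans ?_ (pullback_apply Ω id _ _).symm
  rw [mfderiv_id]
  rfl

/-- In the chart at `x` the components of tangent vectors at `x` are unchanged, since the derivative of
the chart at its centre is the identity. -/
theorem d_apply (Ω : DiffForm I M k) (x : M) (v : Fin (k + 1) → E) :
    Ω.d x v = extDeriv (Ω.inChart x) (extChartAt I x x) v := by
  rw [d, I.range_eq_univ, extDerivWithin_univ, mfderiv_extChartAt_self]
  rfl

/-- The exterior derivative of a smooth form may be computed in any chart. -/
theorem inChart_d {Ω : DiffForm I M k} (hΩ : Ω.IsSmooth) {x₀ : M} {y : E}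
    (hy : y ∈ (extChartAt I x₀).target) : Ω.d.inChart x₀ y = extDeriv (Ω.inChart x₀) y := by
  set x := (extChartAt I x₀).symm y with hx
  have hy' : x ∈ (extChartAt I x).source := mem_extChartAt_source x
  set F := extChartAt I x ∘ id ∘ (extChartAt I x₀).symm with hF
  have h1 : Ω.inChart x₀ =ᶠ[𝓝 y] fun z =>
      (Ω.inChart x (F z)).compContinuousLinearMap (fderiv ℝ F z) := by
    filter_upwards [eventually_chart_comp_mem (contMDiff_id (I := I) (M := M)) hy hy'] with z hz
    exact inChart_eq_comp Ω hz.1 hz.2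
  have hFy : ContDiffAt ℝ ∞ F y := contDiffAt_chart_comp contMDiff_id hy hy'
  have hd : DifferentiableAt ℝ (Ω.inChart x) (F y) :=
    hΩ.differentiableAt ((extChartAt I x).map_source hy')
  rw [h1.extDeriv_eq, extDeriv_pullback hd hFy minSmoothness_two_le_infty, inChart_eq_comp Ω.d hy hy']
  congr 1
  ext v
  refine (inChart_apply Ω.d x (F y) v).trans ?_
  refine (apply_congr Ω.d ((extChartAt I x).left_inv hy') _).trans ?_
  refine (d_apply Ω x _).trans ?_
  have h3 : mfderiv 𝓘(ℝ, E) I (extChartAt I x).symm (F y) = ContinuousLinearMap.id ℝ E := by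
    rw [← mfderivWithin_univ, ← I.range_eq_univ]
    exact mfderivWithin_range_extChartAt_symm
  rw [h3]
  rfl

theorem IsSmooth.d {Ω : DiffForm I M k} (hΩ : Ω.IsSmooth) : Ω.d.IsSmooth := by
  intro x₀
  have h : ContDiffOn ℝ ∞ (extDeriv (Ω.inChart x₀)) (extChartAt I x₀).target :=
    (ContinuousAlternatingMap.alternatizeUncurryFinCLM ℝ E ℝ).contDiff.comp_contDiffOn
      ((hΩ x₀).fderiv_of_isOpen (isOpen_extChartAt_target x₀) (by simp))
  exact h.congr fun y hy => inChart_d hΩ hy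

theorem IsSmooth.d_d {Ω : DiffForm I M k} (hΩ : Ω.IsSmooth) : Ω.d.d = 0 := by
  funext x
  ext v
  have h : Ω.d.inChart x =ᶠ[𝓝 (extChartAt I x x)] extDeriv (Ω.inChart x) := by
    filter_upwards [extChartAt_target_mem_nhds (I := I) x] with y hy using inChart_d hΩ hy
  refine (d_apply Ω.d x v).trans ?_
  rw [h.extDeriv_eq, extDeriv_extDeriv_apply (hΩ.contDiffAt (mem_extChartAt_target x))
    minSmoothness_two_le_infty]
  rfl

/-- The exterior derivative commutes with pullbacks. -/
theorem IsSmooth.pullback_d {Ω : DiffForm I' M' k} (hΩ : Ω.IsSmooth) {f : M → M'}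
    (hf : ContMDiff I I' ∞ f) : (Ω.d.pullback f : DiffForm I M (k + 1)) = (Ω.pullback f).d := by
  funext x
  ext v
  have hx := mem_extChartAt_target (I := I) x
  have hx' : f ((extChartAt I x).symm (extChartAt I x x)) ∈ (extChartAt I' (f x)).source := by
    rw [extChartAt_to_inv]; exact mem_extChartAt_source _
  set F := extChartAt I' (f x) ∘ f ∘ (extChartAt I x).symm with hFdef
  have h : (Ω.pullback f : DiffForm I M k).inChart x =ᶠ[𝓝 (extChartAt I x x)] fun z =>
      (Ω.inChart (f x) (F z)).compContinuousLinearMap (fderiv ℝ F z) := by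
    filter_upwards [eventually_chart_comp_mem hf hx hx'] with z hz
    exact inChart_pullback Ω hf hz.1 hz.2
  have hF : ContDiffAt ℝ ∞ F (extChartAt I x x) := contDiffAt_chart_comp hf hx hx'
  have hFx : F (extChartAt I x x) = extChartAt I' (f x) (f x) := by simp [hFdef]
  have hd : DifferentiableAt ℝ (Ω.inChart (f x)) (F (extChartAt I x x)) := by
    rw [hFx]
    exact hΩ.differentiableAt (mem_extChartAt_target _)
  change (Ω.d.pullback f : DiffForm I M (k + 1)) x v = _
  refine Eq.trans ?_ (d_apply (Ω.pullback f : DiffForm I M k) x v).symm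
  rw [h.extDeriv_eq, extDeriv_pullback hd hF minSmoothness_two_le_infty, hFx]
  refine (d_apply Ω (f x) _).trans ?_
  refine congrArg (extDeriv (Ω.inChart (f x)) (extChartAt I' (f x) (f x))) ?_
  funext i
  have hm := (hf.mdifferentiable (by simp) x).mfderiv
  rw [writtenInExtChartAt, I.range_eq_univ, fderivWithin_univ] at hm
  exact DFunLike.congr_fun hm (v i)

theorem d_neg (Ω : DiffForm I M k) : (-Ω).d = -Ω.d := by
  funext x
  ext v
  refine (d_apply (-Ω) x v).trans ?_
  rw [inChart_neg, ← neg_one_smul ℝ, extDeriv_smul, neg_one_smul]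
  exact congrArg Neg.neg (d_apply Ω x v).symm

theorem IsSmooth.d_add {Ω Ω' : DiffForm I M k} (hΩ : Ω.IsSmooth) (hΩ' : Ω'.IsSmooth) :
    (Ω + Ω').d = Ω.d + Ω'.d := by
  funext x
  ext v
  refine (d_apply (Ω + Ω') x v).trans ?_
  rw [inChart_add, extDeriv_add (hΩ.differentiableAt (mem_extChartAt_target x))
    (hΩ'.differentiableAt (mem_extChartAt_target x))]
  exact congrArg₂ (· + ·) (d_apply Ω x v).symm (d_apply Ω' x v).symm

/-- Pullbacks of smooth 1-forms are smooth. -/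
theorem IsSmooth.pullback {Ω : DiffForm I' M' 1} (hΩ : Ω.IsSmooth) {f : M → M'}
    (hf : ContMDiff I I' ∞ f) : (Ω.pullback f : DiffForm I M 1).IsSmooth := by
  intro x₀ y hy
  set x := (extChartAt I x₀).symm y with hx
  have hy' : f x ∈ (extChartAt I' (f x)).source := mem_extChartAt_source _
  set F := extChartAt I' (f x) ∘ f ∘ (extChartAt I x₀).symm with hFdef
  have hF : ContDiffAt ℝ ∞ F y := contDiffAt_chart_comp hf hy hy'
  have hF' : ContDiffAt ℝ ∞ (fderiv ℝ F) y := hF.fderiv_right (by simp)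
  have h1 : ContDiffAt ℝ ∞ (fun z => Ω.inChart (f x) (F z)) y :=
    ContDiffAt.comp y (g := Ω.inChart (f x)) (f := F)
      (hΩ.contDiffAt ((extChartAt I' (f x)).map_source hy')) hF
  let e : (E' →L[ℝ] ℝ) ≃ₗᵢ[ℝ] E' [⋀^Fin 1]→L[ℝ] ℝ :=
    ContinuousAlternatingMap.ofSubsingletonLIE (0 : Fin 1)
  let e₀ : (E →L[ℝ] ℝ) ≃ₗᵢ[ℝ] E [⋀^Fin 1]→L[ℝ] ℝ :=
    ContinuousAlternatingMap.ofSubsingletonLIE (0 : Fin 1)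
  have h2 : ContDiffAt ℝ ∞
      (fun z => e₀ ((e.symm (Ω.inChart (f x) (F z))).comp (fderiv ℝ F z))) y :=
    e₀.contDiff.contDiffAt.comp y ((e.symm.contDiff.contDiffAt.comp y h1).clm_comp hF')
  refine (h2.congr_of_eventuallyEq ?_).contDiffWithinAt
  filter_upwards [eventually_chart_comp_mem hf hy hy'] with z hz
  rw [inChart_pullback Ω hf hz.1 hz.2]
  obtain ⟨l, hl⟩ := e.surjective (Ω.inChart (f x) (F z))
  rw [← hFdef, ← hl, e.symm_apply_apply]
  rfl

end DiffForm

end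

section

variable {E : Type*} [NormedAddCommGroup E] [NormedSpace ℝ E] {H : Type*} [TopologicalSpace H]
  {I : ModelWithCorners ℝ E H} {M : Type*} [TopologicalSpace M] [ChartedSpace H M]

/-! ### Charts of vector bundles -/

section Bundle

variable {F : Type*} [NormedAddCommGroup F] [NormedSpace ℝ F] {V : M → Type*}
  [TopologicalSpace (Bundle.TotalSpace F V)] [∀ x, TopologicalSpace (V x)] [FiberBundle F V]

theorem extChartAt_target_fst_mem (v₀ : Bundle.TotalSpace F V) {p : E × F}
    (hp : p ∈ (extChartAt (I.prod 𝓘(ℝ, F)) v₀).target) :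
    p.1 ∈ (extChartAt I v₀.proj).target := by
  rw [FiberBundle.extChartAt_target] at hp
  exact hp.1.1

theorem proj_extChartAt_symm (v₀ : Bundle.TotalSpace F V) {p : E × F}
    (hp : p ∈ (extChartAt (I.prod 𝓘(ℝ, F)) v₀).target) :
    ((extChartAt (I.prod 𝓘(ℝ, F)) v₀).symm p).proj = (extChartAt I v₀.proj).symm p.1 := by
  rw [FiberBundle.extChartAt_target] at hp
  rw [FiberBundle.extChartAt]
  exact (trivializationAt F V v₀.proj).proj_symm_apply' hp.1.2

variable [∀ x, AddCommGroup (V x)] [∀ x, Module ℝ (V x)] [VectorBundle ℝ F V]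
  [ContMDiffVectorBundle ∞ F V I] [I.Boundaryless] [IsManifold I ∞ M]

/-- In bundle charts, the derivative of the projection of a vector bundle is `(a, b) ↦ a`. -/
theorem mfderiv_proj_extChartAt_symm (v₀ : Bundle.TotalSpace F V) {p : E × F}
    (hp : p ∈ (extChartAt (I.prod 𝓘(ℝ, F)) v₀).target) (u : E × F) :
    (mfderiv (I.prod 𝓘(ℝ, F)) I (Bundle.TotalSpace.proj : Bundle.TotalSpace F V → M)
      ((extChartAt (I.prod 𝓘(ℝ, F)) v₀).symm p) : E × F →L[ℝ] E)
      ((mfderiv 𝓘(ℝ, E × F) (I.prod 𝓘(ℝ, F)) (extChartAt (I.prod 𝓘(ℝ, F)) v₀).symm p :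
        E × F →L[ℝ] E × F) u) =
    (mfderiv 𝓘(ℝ, E) I (extChartAt I v₀.proj).symm p.1 : E →L[ℝ] E) u.1 := by
  have : IsManifold (I.prod 𝓘(ℝ, F)) ∞ (Bundle.TotalSpace F V) :=
    Bundle.TotalSpace.isManifold F V
  have h1 := ((Bundle.contMDiff_proj (n := ∞) (IB := I) V).mdifferentiable (by simp)
    ((extChartAt (I.prod 𝓘(ℝ, F)) v₀).symm p)).hasMFDerivAt.comp p
    (mdifferentiableAt_extChartAt_symm (I := I.prod 𝓘(ℝ, F)) v₀ hp).hasMFDerivAt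
  have h2 := (mdifferentiableAt_extChartAt_symm (I := I) v₀.proj
    (extChartAt_target_fst_mem v₀ hp)).hasMFDerivAt.comp p
    (hasFDerivAt_fst (𝕜 := ℝ) (E := E) (F := F) (p := p)).hasMFDerivAt
  have h3 : Bundle.TotalSpace.proj ∘ (extChartAt (I.prod 𝓘(ℝ, F)) v₀).symm =ᶠ[𝓝 p]
      (extChartAt I v₀.proj).symm ∘ Prod.fst := by
    filter_upwards [(isOpen_extChartAt_target v₀).mem_nhds hp] with q hq
      using proj_extChartAt_symm v₀ hq
  exact DFunLike.congr_fun (hasMFDerivAt_unique h1 (h2.congr_of_eventuallyEq h3)) u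

end Bundle

variable [I.Boundaryless] [IsManifold I ∞ M]

/-- The vector of `TM` with coordinates `(x, w)` is the image of `w` under the derivative of the
inverse chart. -/
theorem snd_extChartAt_tangent_symm (v₀ : TangentBundle I M) {p : E × E}
    (hp : p ∈ (extChartAt I.tangent v₀).target) :
    (((extChartAt I.tangent v₀).symm p).2 : E) =
      (mfderiv 𝓘(ℝ, E) I (extChartAt I v₀.proj).symm p.1 : E →L[ℝ] E) p.2 := by
  set v := (extChartAt I.tangent v₀).symm p with hv
  have hp1 := extChartAt_target_fst_mem v₀ hp
  have hproj : v.proj = (extChartAt I v₀.proj).symm p.1 := proj_extChartAt_symm v₀ hp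
  have hs : v.proj ∈ (extChartAt I v₀.proj).source := by
    rw [hproj]; exact (extChartAt I v₀.proj).map_target hp1
  have h1 : p.2 = (mfderiv I 𝓘(ℝ, E) (extChartAt I v₀.proj) v.proj : E →L[ℝ] E) v.2 := by
    rw [← JetChart.tangentChart_snd v₀.proj v hs]
    exact congrArg Prod.snd ((extChartAt I.tangent v₀).right_inv hp).symm
  have h2 := mfderivWithin_extChartAt_symm_comp_mfderiv_extChartAt' (I := I) hs
  have h3 : extChartAt I v₀.proj v.proj = p.1 := by
    rw [hproj]; exact (extChartAt I v₀.proj).right_inv hp1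
  rw [h3, I.range_eq_univ, mfderivWithin_univ] at h2
  rw [h1]
  exact (DFunLike.congr_fun h2 v.2).symm

/-- The fibre coordinate of a covector `β` in the chart of `T*M` over the chart of `M` at `x₀`. -/
def cotangentCoord (x₀ : M) (β : CotangentBundle I M) : E →L[ℝ] ℝ :=
  (β.2 : E →L[ℝ] ℝ).comp
    (mfderiv 𝓘(ℝ, E) I (extChartAt I x₀).symm (extChartAt I x₀ β.proj) : E →L[ℝ] E)

theorem snd_trivializationAt_cotangent {x₀ : M} {β : CotangentBundle I M}
    (hβ : β.proj ∈ (extChartAt I x₀).source) :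
    (trivializationAt (E →L[ℝ] ℝ) (fun x : M => TangentSpace I x →L[ℝ] Bundle.Trivial M ℝ x) x₀
      β).2 = cotangentCoord x₀ β := by
  have h2 : (trivializationAt (E →L[ℝ] ℝ)
      (fun x : M => TangentSpace I x →L[ℝ] Bundle.Trivial M ℝ x) x₀ β).2 =
      ContinuousLinearMap.inCoordinates E (TangentSpace I) ℝ (Bundle.Trivial M ℝ)
        x₀ β.proj x₀ β.proj β.2 :=
    congrArg Prod.snd (hom_trivializationAt_apply (RingHom.id ℝ) x₀ β)
  have h4 := TangentBundle.symmL_trivializationAt (I := I) (𝕜 := ℝ) (x₀ := x₀) (x := β.proj)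
    (by simpa using hβ)
  rw [I.range_eq_univ, mfderivWithin_univ] at h4
  rw [h2, cotangentCoord, ← h4]
  ext w
  exact DFunLike.congr_fun (Bundle.Trivial.continuousLinearMapAt_trivialization ℝ M ℝ β.proj) _

/-- The covector of `T*M` with coordinates `(x, q)` pairs with the vector of `TM` with coordinates
`(x, w)` to `q w`. -/
theorem snd_extChartAt_cotangent_symm (α₀ : CotangentBundle I M) {y : E × (E →L[ℝ] ℝ)}
    (hy : y ∈ (extChartAt (cotangentModel I) α₀).target) (w : E) :
    (((extChartAt (cotangentModel I) α₀).symm y).2 : E →L[ℝ] ℝ)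
      ((mfderiv 𝓘(ℝ, E) I (extChartAt I α₀.proj).symm y.1 : E →L[ℝ] E) w) = y.2 w := by
  set β := (extChartAt (cotangentModel I) α₀).symm y with hβ
  have hy1 := extChartAt_target_fst_mem α₀ hy
  have hproj : β.proj = (extChartAt I α₀.proj).symm y.1 := proj_extChartAt_symm α₀ hy
  have hs : β.proj ∈ (extChartAt I α₀.proj).source := by
    rw [hproj]; exact (extChartAt I α₀.proj).map_target hy1
  have h1 : y = extChartAt (cotangentModel I) α₀ β :=
    ((extChartAt (cotangentModel I) α₀).right_inv hy).symm
  have h3 : extChartAt I α₀.proj β.proj = y.1 := by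
    rw [hproj]; exact (extChartAt I α₀.proj).right_inv hy1
  have h2 : y.2 = cotangentCoord α₀.proj β := by
    rw [h1, FiberBundle.extChartAt]
    exact snd_trivializationAt_cotangent hs
  rw [h2, cotangentCoord, h3]
  rfl

/-! ### Contractions and complete lifts -/

namespace DiffForm

variable {k : ℕ}

/-- The coordinate expression of the contraction: at `(x, w)` it is the interior product of the
coordinate expression of the form at `x` with `w`. -/
theorem inChart_contractT (Ω : DiffForm I M (k + 1)) (v₀ : TangentBundle I M) {p : E × E}
    (hp : p ∈ (extChartAt I.tangent v₀).target) :
    Ω.contractT.inChart v₀ p =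
      ((Ω.inChart v₀.proj p.1).curryLeft p.2).compContinuousLinearMap
        (ContinuousLinearMap.fst ℝ E E) := by
  ext u
  refine (inChart_apply Ω.contractT v₀ p u).trans ?_
  refine Eq.trans ?_ (inChart_apply Ω v₀.proj p.1 (Matrix.vecCons p.2 fun i => (u i).1)).symm
  set v := (extChartAt I.tangent v₀).symm p with hv
  refine Eq.trans ?_ (apply_congr Ω (proj_extChartAt_symm (I := I) v₀ hp) _)
  change (Ω v.proj : E [⋀^Fin (k + 1)]→L[ℝ] ℝ) (Matrix.vecCons (v.2 : E) fun i =>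
    (mfderiv I.tangent I (Bundle.TotalSpace.proj : TangentBundle I M → M) v : E × E →L[ℝ] E)
      ((mfderiv 𝓘(ℝ, E × E) I.tangent (extChartAt I.tangent v₀).symm p : E × E →L[ℝ] E × E) (u i))) = _
  refine congrArg (Ω v.proj : E [⋀^Fin (k + 1)]→L[ℝ] ℝ) ?_
  funext i
  refine Fin.cases ?_ (fun i => ?_) i
  · exact snd_extChartAt_tangent_symm v₀ hp
  · exact mfderiv_proj_extChartAt_symm (I := I) v₀ hp (u i)

theorem IsSmooth.contractT {Ω : DiffForm I M (k + 1)} (hΩ : Ω.IsSmooth) : Ω.contractT.IsSmooth := by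
  intro v₀
  let e : (E [⋀^Fin (k + 1)]→L[ℝ] ℝ) →L[ℝ] E →L[ℝ] E [⋀^Fin k]→L[ℝ] ℝ :=
    (ContinuousAlternatingMap.curryLeftLI (𝕜 := ℝ) (E := E) (F := ℝ)).toContinuousLinearMap
  have he : ContDiff ℝ ∞ e := by fun_prop
  let c : (E [⋀^Fin k]→L[ℝ] ℝ) →L[ℝ] (E × E) [⋀^Fin k]→L[ℝ] ℝ :=
    ContinuousAlternatingMap.compContinuousLinearMapCLM (ContinuousLinearMap.fst ℝ E E)
  have h1 : ContDiffOn ℝ ∞ (fun p : E × E => Ω.inChart v₀.proj p.1)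
      (extChartAt I.tangent v₀).target :=
    (hΩ v₀.proj).comp contDiffOn_fst fun p hp => extChartAt_target_fst_mem v₀ hp
  have h2 : ContDiffOn ℝ ∞ (fun p : E × E => c (e (Ω.inChart v₀.proj p.1) p.2))
      (extChartAt I.tangent v₀).target :=
    c.contDiff.comp_contDiffOn
      (ContDiffOn.clm_apply (f := fun p : E × E => e (Ω.inChart v₀.proj p.1))
        (he.comp_contDiffOn h1) contDiffOn_snd)
  exact h2.congr fun p hp => inChart_contractT Ω v₀ hp

omit [I.Boundaryless] in
theorem contractT_neg (Ω : DiffForm I M (k + 1)) : (-Ω).contractT = -Ω.contractT := rfl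

omit [I.Boundaryless] in
theorem contractT_zero : (0 : DiffForm I M (k + 1)).contractT = 0 := rfl

theorem completeLift_neg (Ω : DiffForm I M (k + 1)) : (-Ω).completeLift = -Ω.completeLift := by
  rw [completeLift, completeLift, d_neg, contractT_neg, contractT_neg, d_neg, neg_add]

theorem IsSmooth.completeLift {Ω : DiffForm I M (k + 1)} (hΩ : Ω.IsSmooth) :
    Ω.completeLift.IsSmooth :=
  hΩ.d.contractT.add hΩ.contractT.d

/-- The complete lift commutes with the exterior derivative. -/
theorem IsSmooth.completeLift_d {Ω : DiffForm I M (k + 1)} (hΩ : Ω.IsSmooth) :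
    Ω.d.completeLift = Ω.completeLift.d := by
  rw [DiffForm.completeLift, DiffForm.completeLift, hΩ.d_d, contractT_zero, zero_add,
    hΩ.d.contractT.d_add hΩ.contractT.d, hΩ.contractT.d_d, add_zero]

theorem IsSmooth.isPresymplectic_neg_d {Ω : DiffForm I M 1} (hΩ : Ω.IsSmooth) :
    (-Ω.d).IsPresymplectic :=
  ⟨hΩ.d.neg, by rw [d_neg, hΩ.d_d, neg_zero]⟩

end DiffForm

/-! ### The Liouville form and its complete lift -/

theorem inChart_liouvilleForm (α₀ : CotangentBundle I M) {y : E × (E →L[ℝ] ℝ)}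
    (hy : y ∈ (extChartAt (cotangentModel I) α₀).target) :
    (liouvilleForm I).inChart α₀ y = ContinuousAlternatingMap.ofSubsingleton ℝ _ ℝ 0
      (y.2.comp (ContinuousLinearMap.fst ℝ E (E →L[ℝ] ℝ))) := by
  ext u
  refine (DiffForm.inChart_apply (liouvilleForm I) α₀ y u).trans ?_
  change (((extChartAt (cotangentModel I) α₀).symm y).2 : E →L[ℝ] ℝ)
    ((mfderiv (cotangentModel I) I (CotangentBundle.proj I)
      ((extChartAt (cotangentModel I) α₀).symm y) : E × (E →L[ℝ] ℝ) →L[ℝ] E)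
      ((mfderiv 𝓘(ℝ, E × (E →L[ℝ] ℝ)) (cotangentModel I) (extChartAt (cotangentModel I) α₀).symm y :
        E × (E →L[ℝ] ℝ) →L[ℝ] E × (E →L[ℝ] ℝ)) (u 0))) = y.2 (u 0).1
  rw [← snd_extChartAt_cotangent_symm α₀ hy]
  exact congrArg _ (mfderiv_proj_extChartAt_symm (I := I) α₀ hy (u 0))

variable (E) in
/-- The coordinate expression `(x, q) ↦ q ∘ pr₁` of the Liouville form, as a linear map. -/
def liouvilleCoord : E × (E →L[ℝ] ℝ) →L[ℝ] (E × (E →L[ℝ] ℝ)) [⋀^Fin 1]→L[ℝ] ℝ :=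
  (ContinuousAlternatingMap.ofSubsingletonLIE (𝕜 := ℝ) (E := E × (E →L[ℝ] ℝ)) (F := ℝ)
    (0 : Fin 1)).toContinuousLinearEquiv.toContinuousLinearMap ∘L
      ((ContinuousLinearMap.compL ℝ (E × (E →L[ℝ] ℝ)) E ℝ).flip
        (ContinuousLinearMap.fst ℝ E (E →L[ℝ] ℝ)) ∘L ContinuousLinearMap.snd ℝ E (E →L[ℝ] ℝ))

theorem liouvilleCoord_apply (y : E × (E →L[ℝ] ℝ)) (u : Fin 1 → E × (E →L[ℝ] ℝ)) :
    liouvilleCoord E y u = y.2 (u 0).1 := rfl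

theorem isSmooth_liouvilleForm : (liouvilleForm I (M := M)).IsSmooth := fun α₀ =>
  (liouvilleCoord E).contDiff.contDiffOn.congr fun _ hy => inChart_liouvilleForm α₀ hy

omit [I.Boundaryless] [IsManifold I ∞ M] in
/-- A tangent vector is determined by its base point and its components there. -/
theorem TangentBundle.ext_components {v v' : TangentBundle I M} (h : v.proj = v'.proj)
    (h' : (v.2 : E) = v'.2) : v = v' := by
  obtain ⟨x, w⟩ := v
  obtain ⟨x', w'⟩ := v'
  obtain rfl : x = x' := h
  obtain rfl : w = w' := h'
  rfl

theorem snd_extChartAt_cotangent_self (α : CotangentBundle I M) :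
    (extChartAt (cotangentModel I) α α).2 = (α.2 : E →L[ℝ] ℝ) := by
  ext w
  have h := snd_extChartAt_cotangent_symm α (mem_extChartAt_target α) w
  have h1 := mfderivWithin_range_extChartAt_symm (I := I) (x := α.proj)
  rw [I.range_eq_univ, mfderivWithin_univ] at h1
  rw [extChartAt_to_inv] at h
  rw [← h]
  exact congrArg (α.2 : E →L[ℝ] ℝ) (DFunLike.congr_fun h1 w)

omit [I.Boundaryless] in
theorem snd_extChartAt_tangent_self (v : TangentBundle I M) :
    (extChartAt I.tangent v v).2 = (v.2 : E) := by
  refine (JetChart.tangentChart_snd v.proj v (mem_extChartAt_source _)).trans ?_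
  rw [mfderiv_extChartAt_self]
  rfl

/-- `dθ = dp ∧ dq`. -/
theorem liouvilleForm_d_apply (α : CotangentBundle I M) (u : Fin 2 → E × (E →L[ℝ] ℝ)) :
    ((liouvilleForm I).d α : (E × (E →L[ℝ] ℝ)) [⋀^Fin 2]→L[ℝ] ℝ) u =
      (u 0).2 (u 1).1 - (u 1).2 (u 0).1 := by
  refine (DiffForm.d_apply (liouvilleForm I) α u).trans ?_
  have h : (liouvilleForm I).inChart α =ᶠ[𝓝 (extChartAt (cotangentModel I) α α)]
      liouvilleCoord E := by
    filter_upwards [extChartAt_target_mem_nhds (I := cotangentModel I) α] with y hy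
      using inChart_liouvilleForm α hy
  have hd : fderiv ℝ (liouvilleCoord E) (extChartAt (cotangentModel I) α α) = liouvilleCoord E :=
    ContinuousLinearMap.fderiv _
  rw [h.extDeriv_eq, extDeriv, hd,
    ContinuousAlternatingMap.alternatizeUncurryFin_apply, Fin.sum_univ_two]
  simp [liouvilleCoord_apply, Fin.removeNth, Fin.tail, sub_eq_add_neg]

/-- The function `i_T θ` on `T(T*M)`, locally `p_i q̇^i`, has differential `p_i dq̇^i + q̇^i dp_i`. -/
theorem liouvilleForm_contractT_d_apply (z : TangentBundle (cotangentModel I) (CotangentBundle I M))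
    (u : Fin 1 → (E × (E →L[ℝ] ℝ)) × (E × (E →L[ℝ] ℝ))) :
    ((liouvilleForm I).contractT.d z :
      ((E × (E →L[ℝ] ℝ)) × (E × (E →L[ℝ] ℝ))) [⋀^Fin 1]→L[ℝ] ℝ) u =
      (z.proj.2 : E →L[ℝ] ℝ) (u 0).2.1 + (u 0).1.2 (z.2 : E × (E →L[ℝ] ℝ)).1 := by
  refine (DiffForm.d_apply (liouvilleForm I).contractT z u).trans ?_
  have h : (liouvilleForm I).contractT.inChart z
      =ᶠ[𝓝 (extChartAt (cotangentModel I).tangent z z)] fun p =>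
        ContinuousAlternatingMap.constOfIsEmpty ℝ _ (Fin 0) (p.1.2 p.2.1) := by
    filter_upwards [extChartAt_target_mem_nhds (I := (cotangentModel I).tangent) z] with p hp
    rw [DiffForm.inChart_contractT _ z hp,
      inChart_liouvilleForm z.proj (extChartAt_target_fst_mem z hp)]
    ext v
    rfl
  rw [h.extDeriv_eq, extDeriv_constOfIsEmpty]
  set p₀ := extChartAt (cotangentModel I).tangent z z with hp₀
  have h1 : p₀.1.2 = (z.proj.2 : E →L[ℝ] ℝ) := snd_extChartAt_cotangent_self z.proj
  have h2 : p₀.2 = (z.2 : E × (E →L[ℝ] ℝ)) := snd_extChartAt_tangent_self z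
  have h3 : HasFDerivAt (fun p : (E × (E →L[ℝ] ℝ)) × (E × (E →L[ℝ] ℝ)) => p.1.2 p.2.1) _ p₀ :=
    (hasFDerivAt_snd.comp p₀ hasFDerivAt_fst).clm_apply (hasFDerivAt_fst.comp p₀ hasFDerivAt_snd)
  rw [h3.fderiv, ← h1, ← h2]
  rfl

omit [I.Boundaryless] in
theorem mfderiv_totalSpace_proj_tangent (v : TangentBundle I M) (u : E × E) :
    (mfderiv I.tangent I (Bundle.TotalSpace.proj : TangentBundle I M → M) v : E × E →L[ℝ] E) u =
      u.1 := by
  have hc : ContinuousAt (Bundle.TotalSpace.proj : TangentBundle I M → M) v :=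
    (FiberBundle.continuous_proj E (TangentSpace I)).continuousAt
  have he : ∀ y ∈ (extChartAt I.tangent v).target, writtenInExtChartAt I.tangent I v
      (Bundle.TotalSpace.proj : TangentBundle I M → M) y = y.1 := fun y hy =>
    congrArg Prod.fst ((extChartAt I.tangent v).right_inv hy)
  have h : HasMFDerivAt I.tangent I (Bundle.TotalSpace.proj : TangentBundle I M → M) v
      (ContinuousLinearMap.fst ℝ E E) :=
    ⟨hc, hasFDerivWithinAt_fst.congr_of_eventuallyEq
      (Filter.eventuallyEq_of_mem (extChartAt_target_mem_nhdsWithin v) he)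
      (he _ (mem_extChartAt_target v))⟩
  exact DFunLike.congr_fun h.mfderiv u

/-- The complete lift of the Liouville form is locally `ṗ_i dq^i + p_i dq̇^i`. -/
theorem liouvilleForm_completeLift_apply
    (z : TangentBundle (cotangentModel I) (CotangentBundle I M))
    (u : Fin 1 → (E × (E →L[ℝ] ℝ)) × (E × (E →L[ℝ] ℝ))) :
    ((liouvilleForm I).completeLift z :
      ((E × (E →L[ℝ] ℝ)) × (E × (E →L[ℝ] ℝ))) [⋀^Fin 1]→L[ℝ] ℝ) u =
      (z.2 : E × (E →L[ℝ] ℝ)).2 (u 0).1.1 + (z.proj.2 : E →L[ℝ] ℝ) (u 0).2.1 := by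
  have h1 : ((liouvilleForm I).d.contractT z :
      ((E × (E →L[ℝ] ℝ)) × (E × (E →L[ℝ] ℝ))) [⋀^Fin 1]→L[ℝ] ℝ) u =
      (z.2 : E × (E →L[ℝ] ℝ)).2 (u 0).1.1 - (u 0).1.2 (z.2 : E × (E →L[ℝ] ℝ)).1 := by
    have h := liouvilleForm_d_apply z.proj (Matrix.vecCons (z.2 : E × (E →L[ℝ] ℝ))
      fun i => (u i).1)
    refine Eq.trans ?_ h
    refine congrArg ((liouvilleForm I).d z.proj : (E × (E →L[ℝ] ℝ)) [⋀^Fin 2]→L[ℝ] ℝ) ?_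
    funext i
    refine Fin.cases rfl (fun i => ?_) i
    exact mfderiv_totalSpace_proj_tangent (I := cotangentModel I) z (u i)
  have h2 := liouvilleForm_contractT_d_apply z u
  refine (congrArg₂ (· + ·) h1 h2).trans ?_
  ring

/-! ### The Tulczyjew map -/

omit [I.Boundaryless] in
theorem contMDiff_cotangentProj : ContMDiff (cotangentModel I) I ∞ (CotangentBundle.proj I (M := M)) :=
  Bundle.contMDiff_proj _

omit [I.Boundaryless] in
/-- The composition of `A_M` and the projection `T*(TM) → TM` is `Tπ_M`. -/
theorem tulczyjew_proj (z : TangentBundle (cotangentModel I) (CotangentBundle I M)) :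
    (tulczyjew I z).proj = tangentMap (cotangentModel I) I (CotangentBundle.proj I) z := by
  rw [tangentMap, mfderiv_cotangentProj]
  rfl

omit [I.Boundaryless] in
theorem contMDiff_tulczyjew_proj : ContMDiff (cotangentModel I).tangent I.tangent ∞
    fun z : TangentBundle (cotangentModel I) (CotangentBundle I M) => (tulczyjew I z).proj := by
  have h := contMDiff_cotangentProj (I := I) (M := M).contMDiff_tangentMap (m := ∞) (by simp)
  exact h.congr fun z => tulczyjew_proj z

theorem mfderiv_tulczyjew_proj (z : TangentBundle (cotangentModel I) (CotangentBundle I M))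
    (u : (E × (E →L[ℝ] ℝ)) × (E × (E →L[ℝ] ℝ))) :
    (mfderiv (cotangentModel I).tangent I.tangent
      (fun z : TangentBundle (cotangentModel I) (CotangentBundle I M) => (tulczyjew I z).proj) z :
        (E × (E →L[ℝ] ℝ)) × (E × (E →L[ℝ] ℝ)) →L[ℝ] E × E) u = (u.1.1, u.2.1) := by
  set f := fun z : TangentBundle (cotangentModel I) (CotangentBundle I M) => (tulczyjew I z).proj
    with hf
  -- `Tπ_M` is given by the linear map `L` in the charts at `z` and `f z`
  let L : (E × (E →L[ℝ] ℝ)) × (E × (E →L[ℝ] ℝ)) →L[ℝ] E × E :=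
    (ContinuousLinearMap.fst ℝ E (E →L[ℝ] ℝ)).prodMap (ContinuousLinearMap.fst ℝ E (E →L[ℝ] ℝ))
  have he : ∀ p ∈ (extChartAt (cotangentModel I).tangent z).target,
      writtenInExtChartAt (cotangentModel I).tangent I.tangent z f p = L p := by
    intro p hp
    have hp1 := extChartAt_target_fst_mem z hp
    have hp2 := extChartAt_target_fst_mem z.proj hp1
    have hL : L p ∈ (extChartAt I.tangent (f z)).target := by
      have h := JetChart.tangentChart_target (I := I) z.proj.proj
      change L p ∈ (JetChart.tangentChart I z.proj.proj).target
      rw [h]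
      exact hp2
    have h : f ((extChartAt (cotangentModel I).tangent z).symm p) =
        (extChartAt I.tangent (f z)).symm (L p) := by
      refine TangentBundle.ext_components ?_ ?_
      · have h1 := proj_extChartAt_symm (I := cotangentModel I) z hp
        have h2 := proj_extChartAt_symm (I := I) z.proj hp1
        have h3 := proj_extChartAt_symm (I := I) (f z) hL
        refine Eq.trans ?_ h3.symm
        exact (congrArg (CotangentBundle.proj I) h1).trans h2
      · refine Eq.trans ?_ (snd_extChartAt_tangent_symm (I := I) (f z) hL).symm
        have h1 := snd_extChartAt_tangent_symm (I := cotangentModel I) z hp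
        have h2 := mfderiv_proj_extChartAt_symm (I := I) z.proj hp1 p.2
        refine (congrArg Prod.fst h1).trans (Eq.trans ?_ h2)
        have h3 := mfderiv_cotangentProj ((extChartAt (cotangentModel I) z.proj).symm p.1)
        exact (DFunLike.congr_fun h3 _).symm
    change extChartAt I.tangent (f z) (f ((extChartAt (cotangentModel I).tangent z).symm p)) = L p
    rw [h, (extChartAt I.tangent (f z)).right_inv hL]
  have h : HasMFDerivAt (cotangentModel I).tangent I.tangent f z L :=
    ⟨contMDiff_tulczyjew_proj.continuous.continuousAt,
      L.hasFDerivWithinAt.congr_of_eventuallyEq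
        (Filter.eventuallyEq_of_mem (extChartAt_target_mem_nhdsWithin z) he)
        (he _ (mem_extChartAt_target z))⟩
  exact DFunLike.congr_fun h.mfderiv u

/-- At each point `z`, the complete lift of the Liouville form of `T*M` is the covector `A_M(z)` pulled
back along `Tπ_M`. Equivalently, it is the pullback by `A_M` of the Liouville form of `T*(TM)`. -/
theorem liouvilleForm_completeLift_eq (z : TangentBundle (cotangentModel I) (CotangentBundle I M))
    (u : Fin 1 → (E × (E →L[ℝ] ℝ)) × (E × (E →L[ℝ] ℝ))) :
    ((liouvilleForm I).completeLift z :
      ((E × (E →L[ℝ] ℝ)) × (E × (E →L[ℝ] ℝ))) [⋀^Fin 1]→L[ℝ] ℝ) u =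
    ((tulczyjew I z).2 : E × E →L[ℝ] ℝ)
      ((mfderiv (cotangentModel I).tangent I.tangent
        (fun z : TangentBundle (cotangentModel I) (CotangentBundle I M) => (tulczyjew I z).proj) z :
          (E × (E →L[ℝ] ℝ)) × (E × (E →L[ℝ] ℝ)) →L[ℝ] E × E) (u 0)) := by
  rw [mfderiv_tulczyjew_proj, liouvilleForm_completeLift_apply]
  rfl

end

section

variable {E : Type*} [NormedAddCommGroup E] [NormedSpace ℝ E] {H : Type*} [TopologicalSpace H]
  {I : ModelWithCorners ℝ E H} {M : Type*} [TopologicalSpace M] [ChartedSpace H M]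
  [I.Boundaryless] [IsManifold I ∞ M]
  {E' : Type*} [NormedAddCommGroup E'] [NormedSpace ℝ E'] {H' : Type*} [TopologicalSpace H']
  {I' : ModelWithCorners ℝ E' H'} {M' : Type*} [TopologicalSpace M'] [ChartedSpace H' M']
  [I'.Boundaryless] [IsManifold I' ∞ M']
  {E₁ : Type*} [NormedAddCommGroup E₁] [NormedSpace ℝ E₁] {H₁ : Type*} [TopologicalSpace H₁]
  {J : ModelWithCorners ℝ E₁ H₁} {N : Type*} [TopologicalSpace N] [ChartedSpace H₁ N]

/-! ### Smoothness of maps into cotangent bundles -/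

omit [I'.Boundaryless] [IsManifold I' ∞ M'] in
theorem contMDiffAt_cotangentBundle_iff {c : N → CotangentBundle I M} {z₀ : N} :
    ContMDiffAt J (cotangentModel I) ∞ c z₀ ↔ ContMDiffAt J I ∞ (fun z => (c z).proj) z₀ ∧
      ContMDiffAt J 𝓘(ℝ, E →L[ℝ] ℝ) ∞ (fun z => cotangentCoord (c z₀).proj (c z)) z₀ := by
  refine Bundle.contMDiffAt_totalSpace.trans (and_congr_right fun h => ?_)
  refine Filter.EventuallyEq.contMDiffAt_iff ?_
  filter_upwards [h.continuousAt.eventually_mem (extChartAt_source_mem_nhds (I := I) (c z₀).proj)]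
    with z hz using snd_trivializationAt_cotangent hz

/-- Restricting covectors along a smooth map `g` preserves smoothness. -/
theorem ContMDiffAt.cotangentBundle_comp_mfderiv {g : M → M'} (hg : ContMDiff I I' ∞ g)
    {c : N → CotangentBundle I M} {c' : N → CotangentBundle I' M'} {z₀ : N}
    (hc' : ContMDiffAt J (cotangentModel I') ∞ c' z₀)
    (hproj : ContMDiffAt J I ∞ (fun z => (c z).proj) z₀)
    (h : ∀ z, (c' z).proj = g (c z).proj)
    (h' : ∀ z, (c z).2 = (c' z).2.comp (mfderiv I I' g (c z).proj : E →L[ℝ] E')) :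
    ContMDiffAt J (cotangentModel I) ∞ c z₀ := by
  refine contMDiffAt_cotangentBundle_iff.2 ⟨hproj, ?_⟩
  set x₀ := (c z₀).proj with hx₀
  set x₀' := (c' z₀).proj with hx₀'
  set G := extChartAt I' x₀' ∘ g ∘ (extChartAt I x₀).symm with hG
  have hs := hproj.continuousAt.eventually_mem (extChartAt_source_mem_nhds (I := I) x₀)
  have hs' := (contMDiffAt_cotangentBundle_iff.1 hc').1.continuousAt.eventually_mem
    (extChartAt_source_mem_nhds (I := I') x₀')
  have hx : g ((extChartAt I x₀).symm (extChartAt I x₀ x₀)) ∈ (extChartAt I' x₀').source := by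
    rw [extChartAt_to_inv, hx₀, ← h]; exact mem_extChartAt_source _
  have h1 : ContDiffAt ℝ ∞ (fderiv ℝ G) (extChartAt I x₀ x₀) :=
    (DiffForm.contDiffAt_chart_comp hg (mem_extChartAt_target x₀) hx).fderiv_right (by simp)
  have h2 : ContMDiffAt J 𝓘(ℝ, E →L[ℝ] E') ∞ (fun z => fderiv ℝ G (extChartAt I x₀ (c z).proj)) z₀ :=
    h1.contMDiffAt.comp z₀ ((contMDiffAt_extChartAt (x := x₀)).comp z₀ hproj)
  refine ((contMDiffAt_cotangentBundle_iff.1 hc').2.clm_comp h2).congr_of_eventuallyEq ?_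
  filter_upwards [hs, hs'] with z hz hz'
  ext u
  have hz1 := (extChartAt I x₀).map_source hz
  have hz2 : g ((extChartAt I x₀).symm (extChartAt I x₀ (c z).proj)) ∈ (extChartAt I' x₀').source := by
    rw [(extChartAt I x₀).left_inv hz, ← h]; exact hz'
  have h3 := DiffForm.mfderiv_extChartAt_symm_fderiv_chart_comp hg hz1 hz2 u
  have h4 : G (extChartAt I x₀ (c z).proj) = extChartAt I' x₀' (c' z).proj := by
    rw [hG, Function.comp_apply, Function.comp_apply, (extChartAt I x₀).left_inv hz, h]
  rw [(extChartAt I x₀).left_inv hz] at h3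
  change ((c z).2 : E →L[ℝ] ℝ) _ = ((c' z).2 : E' →L[ℝ] ℝ) _
  rw [h', ← h4]
  exact congrArg ((c' z).2 : E' →L[ℝ] ℝ) h3.symm

/-- A field of covectors along a submersion is smooth if its pullback to a 1-form is. The derivative
of the submersion is assumed to split, with right inverse `R`. -/
theorem contMDiffAt_cotangentBundle_of_pullback [CompleteSpace E'] {c : M → CotangentBundle I' M'}
    (hf : ContMDiff I I' ∞ fun z => (c z).proj) {Λ : DiffForm I M 1} (hΛ : Λ.IsSmooth)
    (h : ∀ z (u : Fin 1 → E), (Λ z : E [⋀^Fin 1]→L[ℝ] ℝ) u = ((c z).2 : E' →L[ℝ] ℝ)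
      ((mfderiv I I' (fun z => (c z).proj) z : E →L[ℝ] E') (u 0)))
    (z₀ : M) (R : E' →L[ℝ] E)
    (hR : ∀ u, (mfderiv I I' (fun z => (c z).proj) z₀ : E →L[ℝ] E') (R u) = u) :
    ContMDiffAt I (cotangentModel I') ∞ c z₀ := by
  refine contMDiffAt_cotangentBundle_iff.2 ⟨hf.contMDiffAt, ?_⟩
  set f := fun z => (c z).proj with hfdef
  set F := extChartAt I' (f z₀) ∘ f ∘ (extChartAt I z₀).symm with hF
  set y₀ := extChartAt I z₀ z₀ with hy₀
  have hy : y₀ ∈ (extChartAt I z₀).target := mem_extChartAt_target z₀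
  have hy' : f ((extChartAt I z₀).symm y₀) ∈ (extChartAt I' (f z₀)).source := by
    rw [extChartAt_to_inv]; exact mem_extChartAt_source _
  -- `R` need not split the derivative of `f` away from `z₀`, but `Df ∘ R` stays invertible near `z₀`,
  -- so that `R ∘ (Df ∘ R)⁻¹` is a right inverse of `Df` depending smoothly on the point
  have hD : ContDiffAt ℝ ∞ (fun y => (fderiv ℝ F y).comp R) y₀ :=
    ((DiffForm.contDiffAt_chart_comp hf hy hy').fderiv_right (by simp)).clm_comp contDiffAt_const
  have hD₀ : (fderiv ℝ F y₀).comp R = ContinuousLinearMap.id ℝ E' := by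
    have hm := (hf.mdifferentiable (by simp) z₀).mfderiv
    rw [writtenInExtChartAt, I.range_eq_univ, fderivWithin_univ] at hm
    ext u
    exact (DFunLike.congr_fun hm (R u)).symm.trans (hR u)
  have hinv : ContDiffAt ℝ ∞ (fun y => ((fderiv ℝ F y).comp R).inverse) y₀ := by
    have h1 : ContDiffAt ℝ ∞ ContinuousLinearMap.inverse ((fderiv ℝ F y₀).comp R) := by
      rw [hD₀]; exact contDiffAt_map_inverse (ContinuousLinearEquiv.refl ℝ E')
    exact h1.comp y₀ hD
  have hI : ∀ᶠ y in 𝓝 y₀, ((fderiv ℝ F y).comp R).IsInvertible := by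
    refine hD.continuousAt.eventually_mem (s := {L | L.IsInvertible})
      ((ContinuousLinearEquiv.isOpen (𝕜 := ℝ)).mem_nhds ?_)
    exact ⟨ContinuousLinearEquiv.refl ℝ E', hD₀.symm⟩
  let e : (E →L[ℝ] ℝ) ≃ₗᵢ[ℝ] E [⋀^Fin 1]→L[ℝ] ℝ :=
    ContinuousAlternatingMap.ofSubsingletonLIE (0 : Fin 1)
  have hG : ContDiffAt ℝ ∞ (fun y => ((e.symm (Λ.inChart z₀ y)).comp R).comp
      ((fderiv ℝ F y).comp R).inverse) y₀ :=
    ((e.symm.contDiff.contDiffAt.comp y₀ (hΛ.contDiffAt hy)).clm_comp contDiffAt_const).clm_comp hinv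
  have hcont := continuousAt_extChartAt (I := I) z₀
  refine (hG.contMDiffAt.comp z₀ (contMDiffAt_extChartAt (x := z₀))).congr_of_eventuallyEq ?_
  filter_upwards [extChartAt_source_mem_nhds (I := I) z₀, hcont.eventually hI,
    hcont.eventually (DiffForm.eventually_chart_comp_mem hf hy hy')] with z hz hzI hz'
  set y := extChartAt I z₀ z with hyz
  have hzy : (extChartAt I z₀).symm y = z := (extChartAt I z₀).left_inv hz
  -- in coordinates, `c` composed with the derivative of `f` is the 1-form `Λ`
  have hkey : ∀ u, cotangentCoord (f z₀) (c z) (fderiv ℝ F y u) = e.symm (Λ.inChart z₀ y) u := by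
    intro u
    have h1 := DiffForm.mfderiv_extChartAt_symm_fderiv_chart_comp hf hz'.1 hz'.2 u
    have h2 : F y = extChartAt I' (f z₀) (c z).proj := by
      rw [hF, Function.comp_apply, Function.comp_apply, hzy]
    obtain ⟨l, hl⟩ := e.surjective (Λ.inChart z₀ y)
    rw [← hl, e.symm_apply_apply]
    have h3 : l u = Λ.inChart z₀ y (fun _ => u) := by rw [← hl]; rfl
    rw [h3]
    refine Eq.trans ?_ (DiffForm.inChart_apply Λ z₀ y _).symm
    refine Eq.trans ?_ (DiffForm.apply_congr Λ hzy.symm _)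
    refine Eq.trans ?_ (h z _).symm
    change ((c z).2 : E' →L[ℝ] ℝ) ((mfderiv 𝓘(ℝ, E') I' (extChartAt I' (f z₀)).symm
      (extChartAt I' (f z₀) (c z).proj) : E' →L[ℝ] E') (fderiv ℝ F y u)) = _
    rw [← h2]
    rw [hzy] at h1
    exact congrArg ((c z).2 : E' →L[ℝ] ℝ) h1
  ext w
  exact (congrArg (cotangentCoord (f z₀) (c z)) (hzI.self_apply_inverse w)).symm.trans (hkey _)

theorem contMDiff_tulczyjew [CompleteSpace E] :
    ContMDiff (cotangentModel I).tangent (cotangentModel I.tangent) ∞ (tulczyjew I (M := M)) := by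
  intro z
  refine contMDiffAt_cotangentBundle_of_pullback contMDiff_tulczyjew_proj
    isSmooth_liouvilleForm.completeLift
    liouvilleForm_completeLift_eq z ((ContinuousLinearMap.inl ℝ E (E →L[ℝ] ℝ)).prodMap
      (ContinuousLinearMap.inl ℝ E (E →L[ℝ] ℝ))) fun u => ?_
  rw [mfderiv_tulczyjew_proj]
  rfl

end

section

variable {E : Type*} [NormedAddCommGroup E] [NormedSpace ℝ E] {H : Type*} [TopologicalSpace H]
  {I : ModelWithCorners ℝ E H} {M : Type*} [TopologicalSpace M] [ChartedSpace H M]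
  [IsManifold I ∞ M] [FiniteDimensional ℝ E] [I.Boundaryless] {π : M → ℝ}
  {E₁ : Type*} [NormedAddCommGroup E₁] [NormedSpace ℝ E₁] {H₁ : Type*} [TopologicalSpace H₁]
  {J : ModelWithCorners ℝ E₁ H₁} {N : Type*} [TopologicalSpace N] [ChartedSpace H₁ N]

/-! ### The jet bundle as an embedded submanifold -/

namespace JetBundle

theorem contMDiff_incl (hπ : IsFibration I π) :
    ContMDiff 𝓘(ℝ, E × JetFibre E) I.tangent ∞ (incl : JetBundle hπ → TangentBundle I M) := by
  intro v₀
  have h1 : ContMDiffAt 𝓘(ℝ, E × JetFibre E) 𝓘(ℝ, E × JetFibre E) ∞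
      (extChartAt 𝓘(ℝ, E × JetFibre E) v₀) v₀ := contMDiffAt_extChartAt
  set x₀ := (incl v₀).proj with hx₀
  have hp : (extChartAt 𝓘(ℝ, E × JetFibre E) v₀ v₀).1 ∈ JetChart.domain hπ x₀ :=
    (mem_chart_source (E × JetFibre E) v₀).2
  have h2 : ContDiffAt ℝ ∞ (JetChart.velocity hπ x₀) (extChartAt 𝓘(ℝ, E × JetFibre E) v₀ v₀) :=
    (JetChart.contDiffOn_velocity hπ x₀).contDiffAt
      (((JetChart.isOpen_domain hπ x₀).preimage continuous_fst).mem_nhds hp)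
  have h3 : ContMDiffAt 𝓘(ℝ, E × E) I.tangent ∞ (JetChart.tangentChart I x₀).symm
      (JetChart.velocity hπ x₀ (extChartAt 𝓘(ℝ, E × JetFibre E) v₀ v₀)) :=
    (contMDiffOn_extChartAt_symm (I := I.tangent) (⟨x₀, 0⟩ : TangentBundle I M)).contMDiffAt
      ((isOpen_extChartAt_target _).mem_nhds (JetChart.velocity_mem hπ x₀ hp))
  refine (h3.comp v₀ (h2.contMDiffAt.comp v₀ h1)).congr_of_eventuallyEq ?_
  filter_upwards [(chart hπ x₀).open_source.mem_nhds (mem_chart_source (E × JetFibre E) v₀)]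
    with v hv
  exact (JetChart.lift_coord hπ x₀ hv.1 hv.2 v.eta_incl).symm

/-- A map into `J¹π` is smooth if it is smooth as a map into `TM`. -/
theorem contMDiff_of_comp_incl {hπ : IsFibration I π} {f : N → JetBundle hπ}
    (hf : ContMDiff J I.tangent ∞ fun z => (f z).incl) :
    ContMDiff J 𝓘(ℝ, E × JetFibre E) ∞ f := by
  intro z₀
  refine contMDiffAt_iff_target.2
    ⟨((isInducing_incl hπ).continuous_iff.2 hf.continuous).continuousAt, ?_⟩
  set x₀ := (f z₀).incl.proj with hx₀
  have h1 : ContMDiffAt J 𝓘(ℝ, E × E) ∞ (fun z => JetChart.tangentChart I x₀ (f z).incl) z₀ :=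
    (contMDiffAt_extChartAt (I := I.tangent) (x := (f z₀).incl)).comp z₀ hf.contMDiffAt
  have h2 : ContDiff ℝ ∞ fun p : E × E => (p.1, JetChart.complement hπ x₀ p.2) :=
    contDiff_fst.prodMk ((JetChart.complement hπ x₀).contDiff.comp contDiff_snd)
  exact h2.contMDiff.contMDiffAt.comp z₀ h1

theorem contMDiff_cotangentProj (hπ : IsFibration I π) :
    ContMDiff 𝓘(ℝ, (E × (E →L[ℝ] ℝ)) × JetFibre (E × (E →L[ℝ] ℝ))) 𝓘(ℝ, E × JetFibre E) ∞
      (cotangentProj hπ) :=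
  contMDiff_of_comp_incl (contMDiff_tulczyjew_proj.comp (contMDiff_incl hπ.cotangent))

end JetBundle

/-! ### The Tulczyjew fibration -/

theorem contMDiff_tulczyjewFibration (hπ : IsFibration I π) :
    ContMDiff 𝓘(ℝ, (E × (E →L[ℝ] ℝ)) × JetFibre (E × (E →L[ℝ] ℝ)))
      (cotangentModel 𝓘(ℝ, E × JetFibre E)) ∞ (tulczyjewFibration hπ) := by
  have : CompleteSpace E := FiniteDimensional.complete ℝ E
  intro z₀
  exact ContMDiffAt.cotangentBundle_comp_mfderiv (JetBundle.contMDiff_incl hπ)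
    (c' := fun z : JetBundle hπ.cotangent => tulczyjew I z.incl)
    (contMDiff_tulczyjew.comp (JetBundle.contMDiff_incl hπ.cotangent) z₀)
    (JetBundle.contMDiff_cotangentProj hπ z₀) (fun _ => rfl) (fun _ => rfl)

/-- The Tulczyjew fibration pulls the Liouville form of `T*(J¹π)` back to the restriction of the
complete lift of the Liouville form of `T*M`. -/
theorem pullback_liouvilleForm_tulczyjewFibration (hπ : IsFibration I π) :
    ((liouvilleForm 𝓘(ℝ, E × JetFibre E) (M := JetBundle hπ)).pullback (tulczyjewFibration hπ) :
      DiffForm 𝓘(ℝ, (E × (E →L[ℝ] ℝ)) × JetFibre (E × (E →L[ℝ] ℝ))) (JetBundle hπ.cotangent) 1) =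
    (liouvilleForm I).completeLift.pullback JetBundle.incl := by
  funext z
  ext u
  -- `j¹π_M` is the composition of `Ã_π` with the projection, and `incl ∘ j¹π_M = Tπ_M ∘ j`
  have h1 : mfderiv 𝓘(ℝ, (E × (E →L[ℝ] ℝ)) × JetFibre (E × (E →L[ℝ] ℝ))) 𝓘(ℝ, E × JetFibre E)
      (JetBundle.cotangentProj hπ) z = _ :=
    mfderiv_comp z (g := CotangentBundle.proj 𝓘(ℝ, E × JetFibre E))
      (contMDiff_cotangentProj.mdifferentiable (by simp) _)
      ((contMDiff_tulczyjewFibration hπ).mdifferentiable (by simp) z)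
  have h2 : mfderiv 𝓘(ℝ, (E × (E →L[ℝ] ℝ)) × JetFibre (E × (E →L[ℝ] ℝ))) I.tangent
      (fun z : JetBundle hπ.cotangent => (tulczyjew I z.incl).proj) z = _ :=
    mfderiv_comp z (g := JetBundle.incl) (f := JetBundle.cotangentProj hπ)
      ((JetBundle.contMDiff_incl hπ).mdifferentiable (by simp) _)
      ((JetBundle.contMDiff_cotangentProj hπ).mdifferentiable (by simp) z)
  have h3 : mfderiv 𝓘(ℝ, (E × (E →L[ℝ] ℝ)) × JetFibre (E × (E →L[ℝ] ℝ))) I.tangent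
      (fun z : JetBundle hπ.cotangent => (tulczyjew I z.incl).proj) z = _ :=
    mfderiv_comp z (g := fun z => (tulczyjew I z).proj) (f := JetBundle.incl)
      (contMDiff_tulczyjew_proj.mdifferentiable (by simp) _)
      ((JetBundle.contMDiff_incl hπ.cotangent).mdifferentiable (by simp) z)
  refine Eq.trans ?_ (liouvilleForm_completeLift_eq z.incl _).symm
  have h4 := DFunLike.congr_fun (h2.symm.trans h3) (u 0)
  have h5 := DFunLike.congr_fun h1 (u 0)
  refine Eq.trans ?_ (congrArg ((tulczyjew I z.incl).2 : E × E →L[ℝ] ℝ) h4)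
  exact congrArg ((tulczyjewFibration hπ z).2 : E × JetFibre E →L[ℝ] ℝ) h5.symm

end

section

variable {E : Type*} [NormedAddCommGroup E] [NormedSpace ℝ E] {H : Type*} [TopologicalSpace H]
  {I : ModelWithCorners ℝ E H} {M : Type*} [TopologicalSpace M] [ChartedSpace H M]
  [IsManifold I ∞ M] [FiniteDimensional ℝ E] [I.Boundaryless] {π : M → ℝ}

/-! ### The Tulczyjew fibration is presymplectic -/

/-- The presymplectic form of `J¹π̃_M` is exact, with potential the restriction of `-θ^c`. -/
theorem jetPresymplecticForm_eq (hπ : IsFibration I π) : jetPresymplecticForm hπ =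
    -((liouvilleForm I).completeLift.pullback (JetBundle.incl (hπ := hπ.cotangent)) :
      DiffForm 𝓘(ℝ, (E × (E →L[ℝ] ℝ)) × JetFibre (E × (E →L[ℝ] ℝ))) (JetBundle hπ.cotangent) 1).d := by
  have h := isSmooth_liouvilleForm (I := I) (M := M)
  rw [jetPresymplecticForm, canonicalForm, DiffForm.completeLift_neg, h.completeLift_d,
    ← h.completeLift.pullback_d (JetBundle.contMDiff_incl hπ.cotangent)]
  rfl

theorem isPresymplecticMap_tulczyjewFibration (hπ : IsFibration I π) :
    DiffForm.IsPresymplecticMap (jetPresymplecticForm hπ) (canonicalForm 𝓘(ℝ, E × JetFibre E))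
      (tulczyjewFibration hπ) where
  source := by
    rw [jetPresymplecticForm_eq hπ]
    exact (isSmooth_liouvilleForm.completeLift.pullback
      (JetBundle.contMDiff_incl hπ.cotangent)).isPresymplectic_neg_d
  target := isSmooth_liouvilleForm.isPresymplectic_neg_d
  smooth := contMDiff_tulczyjewFibration hπ
  pullback_eq := by
    rw [jetPresymplecticForm_eq hπ, ← pullback_liouvilleForm_tulczyjewFibration hπ,
      ← isSmooth_liouvilleForm.pullback_d (contMDiff_tulczyjewFibration hπ)]
    rfl

end

end

theorem mainTheorem3 {n : ℕ} {M : Type*} [TopologicalSpace M]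
    [ChartedSpace (EuclideanSpace ℝ (Fin (n + 1))) M] [IsManifold (𝓡 (n + 1)) ∞ M]
    {π : M → ℝ} (hπ : IsFibration (𝓡 (n + 1)) π) :
    DiffForm.IsPresymplecticMap
      (jetPresymplecticForm hπ)
      (canonicalForm 𝓘(ℝ, EuclideanSpace ℝ (Fin (n + 1)) ×
        JetFibre (EuclideanSpace ℝ (Fin (n + 1)))))
      (tulczyjewFibration hπ) :=
  isPresymplecticMap_tulczyjewFibration hπ
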